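/- Let $E$ be a complex Banach space with dual $E'$ and bidual $E''$, and let $J:E\to E''$ be the canonical embedding. For an open set $U\subset E$, a set $A\subset U$ is called $U$-bounded if it is bounded and there is $\varepsilon>0$ with $B(x,\varepsilon)\subset U$ for every $x\in A$. Let $H_b(U)$ be the algebra of holomorphic functions $f:U\to\mathbb C$ that are bounded on every $U$-bounded set, with the topology of uniform convergence on $U$-bounded sets, and let $M_b(U)$ be the set of nonzero continuous linear multiplicative functionals on $H_b(U)$. Let $\pi:M_b(U)\to E''$ be given by $\pi(\varphi)(\gamma)=\varphi(\gamma|_U)$ for $\gamma\in E'$. Put $$\overset\vee{U''}=\{z\in E'':\ \text{there is }\varphi\in M_b(U)\text{ with }\varphi(f|_U)=\tilde f(z)\text{ for every } f\in H_b(E)\},$$ where $\tilde f$ is the Aron--Berner extension of $f$ to $E''$ (the sum of the Aron--Berner extensions of the homogeneous Taylor polynomials of $f$ at $0$). The set $U$ is $H_b(U)$-convex if for every $U$-bounded set $A$ the hull $\widehat A_{H_b(U)}=\{x\in U:\ |f(x)|\le \sup_A|f| \text{ for all } f\in H_b(U)\}$ is $U$-bounded. Finite type polynomials are the linear combinations of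 the functions $\gamma^n$, $\gamma\in E'$, $n\ge 0$. Suppose that $E'$ has the approximation property (the identity of $E'$ can be approximated by continuous finite rank operators uniformly on compact sets). Then the following conditions are equivalent: (i) finite type polynomials are dense in $H_b(E)$; (ii) $\overset\vee{U''}=\pi(M_b(U))$ for every open subset $U$ of $E$; (iii) $\overset\vee{U''}=\pi(M_b(U))$ for every open $H_b(U)$-convex subset $U$ of $E$. If these conditions do not hold, there exists an open $H_b(U)$-convex set $U\subsetneq E$ such that $\pi(M_b(U))\supset J(E)$. -/

import Mathlib

open Topology

noncomputable section

section Domains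

variable {E : Type*} [NormedAddCommGroup E] [NormedSpace ℂ E]

/-- A set `A ⊆ U` is `U`-bounded if it is bounded and bounded away from the complement of `U`. -/
def IsUBounded (U : Set E) (A : Set U) : Prop :=
  Bornology.IsBounded (Subtype.val '' A) ∧ ∃ ε > 0, ∀ x ∈ A, Metric.ball (x : E) ε ⊆ U

/-- Holomorphic (analytic) functions on a set `U` (used for open `U`): at every point of `U` they
are locally the sum of a power series. -/
def IsHolomorphicOnSubtype (U : Set E) (f : U → ℂ) : Prop :=
  ∃ g : E → ℂ, AnalyticOnNhd ℂ g U ∧ ∀ x : U, g x = f x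

/-- Holomorphic functions of bounded type on `U`, as a subalgebra of all functions `U → ℂ`. -/
def boundedTypeSubalgebra (U : Set E) : Subalgebra ℂ (U → ℂ) where
  carrier := {f | IsHolomorphicOnSubtype U f ∧
    ∀ A : Set U, IsUBounded U A → Bornology.IsBounded (f '' A)}
  mul_mem' := by
    rintro f g ⟨⟨F, hF, hFf⟩, hf⟩ ⟨⟨G, hG, hGg⟩, hg⟩
    refine ⟨⟨F * G, hF.mul hG, fun x => by simp [hFf, hGg]⟩, fun A hA => ?_⟩
    obtain ⟨C, hC⟩ := (hf A hA).exists_norm_le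
    obtain ⟨D, hD⟩ := (hg A hA).exists_norm_le
    refine isBounded_iff_forall_norm_le.2 ⟨C * D, ?_⟩
    rintro _ ⟨x, hx, rfl⟩
    have h1 := hC _ ⟨x, hx, rfl⟩
    have h2 := hD _ ⟨x, hx, rfl⟩
    rw [Pi.mul_apply, norm_mul]
    exact mul_le_mul h1 h2 (norm_nonneg _) ((norm_nonneg _).trans h1)
  add_mem' := by
    rintro f g ⟨⟨F, hF, hFf⟩, hf⟩ ⟨⟨G, hG, hGg⟩, hg⟩
    refine ⟨⟨F + G, hF.add hG, fun x => by simp [hFf, hGg]⟩, fun A hA => ?_⟩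
    obtain ⟨C, hC⟩ := (hf A hA).exists_norm_le
    obtain ⟨D, hD⟩ := (hg A hA).exists_norm_le
    refine isBounded_iff_forall_norm_le.2 ⟨C + D, ?_⟩
    rintro _ ⟨x, hx, rfl⟩
    exact (norm_add_le _ _).trans (add_le_add (hC _ ⟨x, hx, rfl⟩) (hD _ ⟨x, hx, rfl⟩))
  algebraMap_mem' := by
    intro c
    refine ⟨⟨fun _ => c, analyticOnNhd_const, fun x => rfl⟩, fun A _ => ?_⟩
    refine isBounded_iff_forall_norm_le.2 ⟨‖c‖, ?_⟩
    rintro _ ⟨x, -, rfl⟩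
    exact le_rfl

/-- The algebra `H_b(U)` of holomorphic functions of bounded type on `U`. -/
def Hb (U : Set E) : Type _ := boundedTypeSubalgebra U

namespace Hb

variable {U V : Set E}

instance : CommRing (Hb U) := inferInstanceAs (CommRing (boundedTypeSubalgebra U))

instance : Algebra ℂ (Hb U) := inferInstanceAs (Algebra ℂ (boundedTypeSubalgebra U))

instance : CoeFun (Hb U) (fun _ => U → ℂ) := ⟨fun f => f.1⟩

/-- `H_b(U)` carries the topology of uniform convergence on `U`-bounded sets. -/
instance : TopologicalSpace (Hb U) :=
  TopologicalSpace.induced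
    (fun f => UniformOnFun.ofFun {A : Set U | IsUBounded U A} (f : U → ℂ)) inferInstance

/-- Restriction `H_b(U) → H_b(V)` for `V ⊆ U`. -/
def restrict (h : V ⊆ U) : Hb U →ₐ[ℂ] Hb V where
  toFun f := ⟨fun x => f (Set.inclusion h x), by
    obtain ⟨⟨F, hF, hFf⟩, hf⟩ := f.2
    refine ⟨⟨F, hF.mono h, fun x => hFf (Set.inclusion h x)⟩, fun A hA => ?_⟩
    have hA' : IsUBounded U (Set.inclusion h '' A) := by
      obtain ⟨hb, ε, hε, hball⟩ := hA
      refine ⟨?_, ε, hε, ?_⟩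
      · rw [Set.image_image]
        exact hb
      · rintro _ ⟨x, hx, rfl⟩
        exact (hball x hx).trans h
    have := hf _ hA'
    rw [Set.image_image] at this
    exact this⟩
  map_one' := rfl
  map_mul' _ _ := rfl
  map_zero' := rfl
  map_add' _ _ := rfl
  commutes' _ := rfl

/-- A continuous linear functional `γ ∈ E'`, seen as the element `γ|_U` of `H_b(U)`. -/
def ofDual (U : Set E) (γ : StrongDual ℂ E) : Hb U :=
  ⟨fun x => γ x, ⟨γ, γ.analyticOnNhd U, fun _ => rfl⟩, fun A hA => by
    have := γ.lipschitz.isBounded_image hA.1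
    rw [Set.image_image] at this
    exact this⟩

lemma continuous_ofDual (U : Set E) : Continuous (ofDual U) := by
  refine continuous_induced_rng.2 (continuous_iff_continuousAt.2 fun γ => ?_)
  refine UniformOnFun.tendsto_iff_tendstoUniformlyOn.2 fun A hA => ?_
  obtain ⟨C, hC⟩ := hA.1.exists_norm_le
  rw [Metric.tendstoUniformlyOn_iff]
  intro ε hε
  have hpos : 0 < ε / (|C| + 1) := by positivity
  filter_upwards [Metric.ball_mem_nhds γ hpos] with η hη x hx
  have hxC : ‖(x : E)‖ ≤ |C| := (hC _ ⟨x, hx, rfl⟩).trans (le_abs_self C)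
  have h1 : ‖γ - η‖ < ε / (|C| + 1) := by
    rw [← dist_eq_norm, dist_comm]; exact hη
  change dist (γ x) (η x) < ε
  rw [dist_eq_norm]
  calc ‖γ x - η x‖ = ‖(γ - η) x‖ := rfl
    _ ≤ ‖γ - η‖ * ‖(x : E)‖ := (γ - η).le_opNorm _
    _ ≤ ‖γ - η‖ * (|C| + 1) := by gcongr; linarith
    _ < ε / (|C| + 1) * (|C| + 1) := by gcongr
    _ = ε := by field_simp

/-- The continuous linear map `E' → H_b(U)`, `γ ↦ γ|_U`. -/
def ofDualL (U : Set E) : StrongDual ℂ E →L[ℂ] Hb U where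
  toFun := ofDual U
  map_add' _ _ := rfl
  map_smul' _ _ := rfl
  cont := continuous_ofDual U

end Hb

/-- The spectrum `M_b(U)`: all nonzero continuous linear multiplicative functionals on `H_b(U)`. -/
abbrev Mb (U : Set E) : Type _ := WeakDual.characterSpace ℂ (Hb U)

/-- The projection `π : M_b(U) → E''`, `π(φ)(γ) = φ(γ|_U)`. -/
def spectrumProj (U : Set E) (φ : Mb U) : StrongDual ℂ (StrongDual ℂ E) :=
  (WeakDual.toStrongDual (φ : WeakDual ℂ (Hb U))).comp (Hb.ofDualL U)

/-- Finite type polynomials on `E`, as a subspace of `H_b(E)`: the linear span of the powers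
`γ ^ n`, `γ ∈ E'`, `n ≥ 0`. -/
def finiteTypePolynomials (E : Type*) [NormedAddCommGroup E] [NormedSpace ℂ E] :
    Submodule ℂ (Hb (Set.univ : Set E)) :=
  Submodule.span ℂ {f | ∃ (γ : StrongDual ℂ E) (n : ℕ), f = Hb.ofDual Set.univ γ ^ n}

/-- The canonical extension to `E''` of a continuous `n`-linear form `A` on `E`, evaluated at
`(z₁, …, zₙ)`. It is defined recursively by
`Ā(z₁, …, zₙ) = z₁ (x ↦ (A(x, ·, …, ·))‾ (z₂, …, zₙ))`, that is,
`Ā(z₁, …, zₙ) = lim_{x₁ → z₁} ⋯ lim_{xₙ → zₙ} A(x₁, …, xₙ)`, with iterated limits along nets in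
`E` that converge weak-star to the points `zᵢ`. -/
def multilinearBidualExt : (n : ℕ) → (Fin n → StrongDual ℂ (StrongDual ℂ E)) →
    (ContinuousMultilinearMap ℂ (fun _ : Fin n => E) ℂ →L[ℂ] ℂ)
  | 0, _ => ContinuousMultilinearMap.apply ℂ (fun _ : Fin 0 => E) ℂ (fun _ => 0)
  | n + 1, z =>
    (z 0).comp
      ((ContinuousLinearMap.compL ℂ E (ContinuousMultilinearMap ℂ (fun _ : Fin n => E) ℂ) ℂ
          (multilinearBidualExt n (Fin.tail z))).comp
        (continuousMultilinearCurryLeftEquiv ℂ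
          (fun _ : Fin (n + 1) => E) ℂ).toContinuousLinearEquiv.toContinuousLinearMap)

/-- The symmetric `n`-linear form `dⁿf(0) / n!` of the Taylor expansion of `f ∈ H_b(E)` at `0`. -/
def taylorForm (f : Hb (Set.univ : Set E)) (n : ℕ) :
    ContinuousMultilinearMap ℂ (fun _ : Fin n => E) ℂ :=
  ((n.factorial : ℂ)⁻¹) • iteratedFDeriv ℂ n (fun x : E => f ⟨x, Set.mem_univ x⟩) 0

/-- `w` is the value at `z ∈ E''` of the Aron-Berner extension of `f ∈ H_b(E)`, i.e. the sum of
the Aron-Berner extensions at `z` of the homogeneous Taylor polynomials of `f` at `0`. -/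
def HasAronBernerValue (f : Hb (Set.univ : Set E)) (z : StrongDual ℂ (StrongDual ℂ E))
    (w : ℂ) : Prop :=
  HasSum (fun n : ℕ => multilinearBidualExt n (fun _ => z) (taylorForm f n)) w

/-- The set of points `z ∈ E''` that are evaluations for `H_b(U)`: there is `φ ∈ M_b(U)` such that
`φ(f|_U)` is the value at `z` of the Aron-Berner extension of `f`, for every `f ∈ H_b(E)`. -/
def evaluationPoints (U : Set E) : Set (StrongDual ℂ (StrongDual ℂ E)) :=
  {z | ∃ φ : Mb U, ∀ f : Hb (Set.univ : Set E),
    HasAronBernerValue f z (φ (Hb.restrict (Set.subset_univ U) f))}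

/-- The `H_b(U)`-hull of `A ⊆ U`. -/
def hbHull (U : Set E) (A : Set U) : Set U :=
  {x | ∀ f : Hb U, ‖f x‖ ≤ ⨆ a : A, ‖f a‖}

/-- `U` is `H_b(U)`-convex if the hull of each `U`-bounded set is `U`-bounded. -/
def IsHbConvex (U : Set E) : Prop :=
  ∀ A : Set U, IsUBounded U A → IsUBounded U (hbHull U A)

/-- The (Grothendieck) approximation property: the identity is a limit of finite rank operators,
uniformly on compact sets. -/
def HasApproximationProperty (X : Type*) [NormedAddCommGroup X] [NormedSpace ℂ X] : Prop :=
  ∀ K : Set X, IsCompact K → ∀ ε > 0, ∃ T : X →L[ℂ] X,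
    FiniteDimensional ℂ T.range ∧ ∀ x ∈ K, ‖T x - x‖ < ε

end Domains

end

/-! (i) implies (ii) by continuity: for a character `φ`, the maps sending `f` to `φ(f|_U)` and to
the Aron-Berner value at `π(φ)` are continuous on `H_b(E)` and agree on powers of functionals, hence
everywhere once these span a dense subspace (`range_spectrumProj_subset`). The opposite inclusion
holds for every `U`.

The rest is a dichotomy on weak continuity at `0`, on bounded sets, of homogeneous polynomials. If
it always holds, an induction on the degree shows that derivatives of polynomials send balls to
totally bounded sets (`totallyBounded_fderiv_image`). So `x ↦ A(·, x, …, x)` has relatively compact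
image of each ball when `A` is symmetric, and the approximation property of `E'` provides a finite
rank operator that nearly fixes this image. Up to a small error, this writes `A(x, …, x)` as a
finite sum of functionals times forms of lower degree, and induction applies
(`IsSymmetricForm.finiteTypeApproximable`). Taylor series converge uniformly on bounded sets, so (i)
follows.

If it fails for some `P`, take `U = {|P| < 1}`, which is `H_b(U)`-convex by the maximum principle.
The failure gives bounded directions, killed by any prescribed finite set of functionals, in which
`P` is not small. On the line through `x` in such a direction `P` has a zero of controlled size.
These zeros form a `U`-bounded family, and an ultrafilter limit of evaluations at them is a
character lying over `J x`. Yet every character satisfies `|φ(P|_U)| ≤ 1`, so points where `|P| > 1`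
are not evaluation points, and (iii) fails. -/

/-! ### Cauchy estimates in Banach spaces, and total boundedness. -/

section CauchyEstimates

variable {E F : Type*} [NormedAddCommGroup E] [NormedSpace ℂ E]
  [NormedAddCommGroup F] [NormedSpace ℂ F]

/-- Cauchy estimate for a directional derivative. -/
theorem norm_fderiv_apply_le_of_forall_norm_eq {f : E → F} (hf : Differentiable ℂ f) {x v : E}
    {r M : ℝ} (hr : 0 < r) (hM : ∀ t : ℂ, ‖t‖ = r → ‖f (x + t • v)‖ ≤ M) :
    ‖fderiv ℂ f x v‖ ≤ M / r := by
  have hline : ∀ t : ℂ, HasDerivAt (fun t : ℂ => x + t • v) v t := fun t => by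
    simpa using ((hasDerivAt_id t).smul_const v).const_add x
  have hd : ∀ t : ℂ, HasDerivAt (fun t : ℂ => f (x + t • v)) (fderiv ℂ f (x + t • v) v) t :=
    fun t => (hf _).hasFDerivAt.comp_hasDerivAt t (hline t)
  have h := Complex.norm_deriv_le_of_forall_mem_sphere_norm_le (c := 0)
    (f := fun t : ℂ => f (x + t • v)) (C := M) hr
    (Differentiable.diffContOnCl fun t => (hd t).differentiableAt) fun t ht =>
      hM t (by simpa using ht)
  rw [(hd 0).deriv] at h
  simpa using h

/-- Cauchy estimate for the Fréchet derivative. -/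
theorem norm_fderiv_le_of_forall_mem_closedBall {f : E → F} (hf : Differentiable ℂ f) {x : E}
    {r M : ℝ} (hr : 0 < r) (hM : ∀ y ∈ Metric.closedBall x r, ‖f y‖ ≤ M) :
    ‖fderiv ℂ f x‖ ≤ M / r := by
  have hM0 : 0 ≤ M := (norm_nonneg _).trans (hM x (Metric.mem_closedBall_self hr.le))
  refine ContinuousLinearMap.opNorm_le_bound _ (by positivity) fun v => ?_
  rcases eq_or_ne v 0 with rfl | hv
  · simp
  have hv' : 0 < ‖v‖ := norm_pos_iff.2 hv
  have h := norm_fderiv_apply_le_of_forall_norm_eq hf (x := x) (v := v) (r := r / ‖v‖) (M := M)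
    (by positivity) fun t ht => hM _ (by
      simp only [Metric.mem_closedBall, dist_self_add_left, norm_smul, ht]
      rw [div_mul_cancel₀ _ hv'.ne'])
  calc _ ≤ _ := h
    _ = M / r * ‖v‖ := by field_simp

/-- Cauchy estimate for iterated derivatives, by iterating the estimate of first order. -/
theorem norm_iteratedFDeriv_le_of_forall_mem_closedBall {f : E → F} (hf : ContDiff ℂ ⊤ f)
    {r M : ℝ} (hr : 0 < r) (k : ℕ) {x : E} (hM : ∀ y ∈ Metric.closedBall x (k * r), ‖f y‖ ≤ M) :
    ‖iteratedFDeriv ℂ k f x‖ ≤ M / r ^ k := by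
  induction k generalizing x with
  | zero => simpa using hM x (by simp)
  | succ k ih =>
    rw [← norm_fderiv_iteratedFDeriv, pow_succ, ← div_div]
    refine norm_fderiv_le_of_forall_mem_closedBall
      (hf.differentiable_iteratedFDeriv (by simp)) hr fun y hy => ih fun z hz => hM z ?_
    rw [Metric.mem_closedBall] at hy hz ⊢
    calc dist z x ≤ dist z y + dist y x := dist_triangle _ _ _
      _ ≤ k * r + r := add_le_add hz hy
      _ = (k + 1 : ℕ) * r := by push_cast; ring

/-- The derivative of an entire function that is bounded on balls is bounded on balls. -/
theorem exists_norm_fderiv_le_of_bounded {f : E → F} (hf : Differentiable ℂ f)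
    (hb : ∀ R : ℝ, ∃ M, ∀ x, ‖x‖ ≤ R → ‖f x‖ ≤ M) (R : ℝ) :
    ∃ M, ∀ x, ‖x‖ ≤ R → ‖fderiv ℂ f x‖ ≤ M := by
  obtain ⟨M, hM⟩ := hb (R + 1)
  refine ⟨M / 1, fun x hx => norm_fderiv_le_of_forall_mem_closedBall hf one_pos fun y hy => hM y ?_⟩
  rw [mem_closedBall_iff_norm] at hy
  calc ‖y‖ = ‖x + (y - x)‖ := by simp
    _ ≤ _ := (norm_add_le _ _).trans (add_le_add hx hy)

/-- An entire function that is bounded on balls is Lipschitz on balls. -/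
theorem exists_norm_sub_le_of_bounded {f : E → F} (hf : Differentiable ℂ f)
    (hb : ∀ R : ℝ, ∃ M, ∀ x, ‖x‖ ≤ R → ‖f x‖ ≤ M) (R : ℝ) :
    ∃ M > 0, ∀ x y, ‖x‖ ≤ R → ‖y‖ ≤ R → ‖f x - f y‖ ≤ M * ‖x - y‖ := by
  obtain ⟨M, hM⟩ := exists_norm_fderiv_le_of_bounded hf hb R
  refine ⟨|M| + 1, by positivity, fun x y hx hy => ?_⟩
  refine (convex_closedBall (0 : E) R).norm_image_sub_le_of_norm_fderiv_le (𝕜 := ℂ)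
    (fun z _ => hf z) (fun z hz => ?_) (by simpa using hy) (by simpa using hx)
  linarith [hM z (by simpa using hz), le_abs_self M]

/-- A set is totally bounded if it is contained in arbitrarily small thickenings of totally
bounded sets. -/
theorem totallyBounded_of_forall_exists_dist_lt {X : Type*} [PseudoMetricSpace X] {s : Set X}
    (h : ∀ ε > 0, ∃ t : Set X, TotallyBounded t ∧ ∀ x ∈ s, ∃ y ∈ t, dist x y < ε) :
    TotallyBounded s := by
  refine Metric.totallyBounded_iff.2 fun ε hε => ?_
  obtain ⟨t, ht, hst⟩ := h (ε / 2) (by positivity)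
  obtain ⟨u, hu, htu⟩ := Metric.totallyBounded_iff.1 ht (ε / 2) (by positivity)
  refine ⟨u, hu, fun x hx => ?_⟩
  obtain ⟨y, hy, hxy⟩ := hst x hx
  obtain ⟨z, hz, hyz⟩ := Set.mem_iUnion₂.1 (htu hy)
  refine Set.mem_iUnion₂.2 ⟨z, hz, ?_⟩
  rw [Metric.mem_ball] at hyz ⊢
  linarith [dist_triangle x y z]

theorem TotallyBounded.add_image2 {X : Type*} [SeminormedAddCommGroup X] {s t : Set X}
    (hs : TotallyBounded s) (ht : TotallyBounded t) :
    TotallyBounded (Set.image2 (· + ·) s t) := by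
  refine Metric.totallyBounded_iff.2 fun ε hε => ?_
  obtain ⟨u, hu, hsu⟩ := Metric.totallyBounded_iff.1 hs (ε / 2) (by positivity)
  obtain ⟨v, hv, htv⟩ := Metric.totallyBounded_iff.1 ht (ε / 2) (by positivity)
  refine ⟨Set.image2 (· + ·) u v, hu.image2 _ hv, ?_⟩
  rintro _ ⟨x, hx, y, hy, rfl⟩
  obtain ⟨a, ha, hxa⟩ := Set.mem_iUnion₂.1 (hsu hx)
  obtain ⟨b, hb, hyb⟩ := Set.mem_iUnion₂.1 (htv hy)
  refine Set.mem_iUnion₂.2 ⟨a + b, Set.mem_image2_of_mem ha hb, ?_⟩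
  rw [Metric.mem_ball] at hxa hyb ⊢
  linarith [dist_add_add_le x y a b]

end CauchyEstimates

/-! ### Homogeneous polynomials as diagonals of multilinear forms. -/

section Diagonal

variable {E : Type*} [NormedAddCommGroup E] [NormedSpace ℂ E]

/-- The homogeneous polynomial `x ↦ A (x, …, x)`. -/
noncomputable def diag {n : ℕ} (A : ContinuousMultilinearMap ℂ (fun _ : Fin n => E) ℂ) (x : E) : ℂ :=
  A fun _ => x

variable {n : ℕ} (A : ContinuousMultilinearMap ℂ (fun _ : Fin n => E) ℂ)

theorem norm_diag_le (x : E) : ‖diag A x‖ ≤ ‖A‖ * ‖x‖ ^ n := by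
  simpa [diag] using A.le_opNorm fun _ => x

theorem contDiff_diag {m : WithTop ℕ∞} : ContDiff ℂ m (diag A) :=
  A.contDiff.comp (contDiff_pi.2 fun _ => contDiff_id)

theorem diag_smul (c : ℂ) (x : E) : diag A (c • x) = c ^ n * diag A x := by
  simpa [diag] using A.map_smul_univ (fun _ => c) fun _ => x

theorem diag_zero [NeZero n] : diag A 0 = 0 :=
  A.map_coord_zero (m := fun _ => (0 : E)) 0 rfl

theorem exists_norm_diag_le (R : ℝ) : ∃ M, ∀ x, ‖x‖ ≤ R → ‖diag A x‖ ≤ M :=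
  ⟨‖A‖ * R ^ n, fun x hx => (norm_diag_le A x).trans (by gcongr)⟩

/-- Expansion of `A (x + y, …, x + y)`. -/
theorem diag_add (x y : E) :
    diag A (x + y) = ∑ s : Finset (Fin n), A (s.piecewise (fun _ => x) fun _ => y) :=
  A.map_add_univ (fun _ => x) fun _ => y

theorem diag_restr {k : ℕ} (s : Finset (Fin n)) (hk : s.card = k) (x y : E) :
    diag (A.restr s hk y) x = A (s.piecewise (fun _ => x) fun _ => y) := by
  simp only [diag, ContinuousMultilinearMap.restr]
  refine congrArg A (funext fun i => ?_)
  by_cases hi : i ∈ s <;> simp [hi]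

end Diagonal

/-! ### Weak continuity of polynomials and compactness of their derivatives. -/

section Polynomials

variable {E : Type*} [NormedAddCommGroup E] [NormedSpace ℂ E]

/-- Continuous polynomials of degree at most `n`. -/
def polyLE (E : Type*) [NormedAddCommGroup E] [NormedSpace ℂ E] (n : ℕ) :
    Submodule ℂ (E → ℂ) :=
  Submodule.span ℂ {f | ∃ k ≤ n, ∃ A : ContinuousMultilinearMap ℂ (fun _ : Fin k => E) ℂ,
    f = diag A}

theorem diag_mem_polyLE {n k : ℕ} (hk : k ≤ n)
    (A : ContinuousMultilinearMap ℂ (fun _ : Fin k => E) ℂ) : diag A ∈ polyLE E n :=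
  Submodule.subset_span ⟨k, hk, A, rfl⟩

theorem contDiff_of_mem_polyLE {n : ℕ} {f : E → ℂ} (hf : f ∈ polyLE E n) : ContDiff ℂ ⊤ f := by
  induction hf using Submodule.span_induction with
  | mem f hf => obtain ⟨k, -, A, rfl⟩ := hf; exact contDiff_diag A
  | zero => exact contDiff_const
  | add f g _ _ hf hg => exact hf.add hg
  | smul c f _ hf => exact hf.const_smul c

theorem exists_norm_le_of_mem_polyLE {n : ℕ} {f : E → ℂ} (hf : f ∈ polyLE E n) (R : ℝ) :
    ∃ M, ∀ x, ‖x‖ ≤ R → ‖f x‖ ≤ M := by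
  induction hf using Submodule.span_induction with
  | mem f hf => obtain ⟨k, -, A, rfl⟩ := hf; exact exists_norm_diag_le A R
  | zero => exact ⟨0, by simp⟩
  | add f g _ _ hf hg =>
    obtain ⟨M, hM⟩ := hf
    obtain ⟨N, hN⟩ := hg
    exact ⟨M + N, fun x hx => (norm_add_le _ _).trans (add_le_add (hM x hx) (hN x hx))⟩
  | smul c f _ hf =>
    obtain ⟨M, hM⟩ := hf
    refine ⟨‖c‖ * M, fun x hx => ?_⟩
    rw [Pi.smul_apply, norm_smul]
    exact mul_le_mul_of_nonneg_left (hM x hx) (norm_nonneg _)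

/-- Differences lower the degree of a polynomial. -/
theorem sub_mem_polyLE {n : ℕ} {f : E → ℂ} (hf : f ∈ polyLE E (n + 1)) (a : E) :
    (fun x => f (x + a) - f x) ∈ polyLE E n := by
  induction hf using Submodule.span_induction with
  | mem f hf =>
    obtain ⟨k, hk, A, rfl⟩ := hf
    -- In the expansion of `A(x + a, …, x + a)` the full index set gives `diag A x`, which cancels;
    -- every other term has at least one slot filled by `a`.
    have h : (fun x => diag A (x + a) - diag A x) =
        ∑ s ∈ Finset.univ.erase (Finset.univ : Finset (Fin k)), diag (A.restr s rfl a) := by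
      funext x
      rw [diag_add, ← Finset.add_sum_erase _ _ (Finset.mem_univ Finset.univ),
        Finset.piecewise_univ, Finset.sum_apply, show A (fun _ => x) = diag A x from rfl,
        add_sub_cancel_left]
      exact Finset.sum_congr rfl fun s _ => (diag_restr A s rfl x a).symm
    rw [h]
    refine Submodule.sum_mem _ fun s hs => diag_mem_polyLE ?_ _
    have := (Finset.card_lt_iff_ne_univ s).2 (Finset.ne_of_mem_erase hs)
    rw [Fintype.card_fin] at this
    omega
  | zero =>
    convert (polyLE E n).zero_mem using 1
    funext x
    simp
  | add f g _ _ hf hg =>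
    convert (polyLE E n).add_mem hf hg using 1
    funext x
    simp only [Pi.add_apply]
    ring
  | smul c f _ hf =>
    convert (polyLE E n).smul_mem c hf using 1
    funext x
    simp only [Pi.smul_apply, smul_eq_mul]
    ring

theorem eq_const_of_mem_polyLE_zero {f : E → ℂ} (hf : f ∈ polyLE E 0) (x : E) : f x = f 0 := by
  induction hf using Submodule.span_induction with
  | mem f hf =>
    obtain ⟨k, hk, A, rfl⟩ := hf
    obtain rfl : k = 0 := by omega
    exact congrArg A (Subsingleton.elim _ _)
  | zero => rfl
  | add f g _ _ hf hg => simp [hf, hg]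
  | smul c f _ hf => simp [hf]

/-- Weak continuity at zero on bounded sets, tested on subspaces of finite codimension. -/
def WeaklyContinuousAtZero (f : E → ℂ) : Prop :=
  ∀ R : ℝ, ∀ ε > 0, ∃ F : Finset (StrongDual ℂ E), ∀ x, ‖x‖ ≤ R → (∀ γ ∈ F, γ x = 0) →
    ‖f x - f 0‖ ≤ ε

theorem weaklyContinuousAtZero_of_mem_polyLE
    (H : ∀ (k : ℕ) (A : ContinuousMultilinearMap ℂ (fun _ : Fin k => E) ℂ),
      WeaklyContinuousAtZero (diag A)) {n : ℕ} {f : E → ℂ} (hf : f ∈ polyLE E n) :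
    WeaklyContinuousAtZero f := by
  classical
  induction hf using Submodule.span_induction with
  | mem f hf => obtain ⟨k, -, A, rfl⟩ := hf; exact H k A
  | zero => exact fun R ε hε => ⟨∅, fun x _ _ => by simpa using hε.le⟩
  | add f g _ _ hf hg =>
    intro R ε hε
    obtain ⟨F, hF⟩ := hf R (ε / 2) (by positivity)
    obtain ⟨G, hG⟩ := hg R (ε / 2) (by positivity)
    refine ⟨F ∪ G, fun x hx h => ?_⟩
    have h1 := hF x hx fun γ hγ => h γ (Finset.mem_union_left _ hγ)
    have h2 := hG x hx fun γ hγ => h γ (Finset.mem_union_right _ hγ)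
    rw [Pi.add_apply, Pi.add_apply, add_sub_add_comm]
    exact (norm_add_le _ _).trans (by linarith)
  | smul c f _ hf =>
    intro R ε hε
    obtain ⟨F, hF⟩ := hf R (ε / (‖c‖ + 1)) (by positivity)
    refine ⟨F, fun x hx h => ?_⟩
    rw [Pi.smul_apply, Pi.smul_apply, ← smul_sub, norm_smul]
    calc ‖c‖ * ‖f x - f 0‖ ≤ (‖c‖ + 1) * (ε / (‖c‖ + 1)) := by
          gcongr
          · linarith
          · exact hF x hx h
      _ = ε := by field_simp

/-- A functional that is small on a subspace `⋂ ker γ`, `γ ∈ F`, is close to the span of `F`. -/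
theorem exists_mem_span_norm_sub_le (F : Finset (StrongDual ℂ E)) (g : StrongDual ℂ E) {ε : ℝ}
    (hε : 0 ≤ ε) (hg : ∀ v, (∀ γ ∈ F, γ v = 0) → ‖g v‖ ≤ ε * ‖v‖) :
    ∃ w ∈ Submodule.span ℂ (F : Set (StrongDual ℂ E)), ‖g - w‖ ≤ ε := by
  let N : Submodule ℂ E := ⨅ γ : F, LinearMap.ker (γ : StrongDual ℂ E).toLinearMap
  have hN : ∀ v, v ∈ N ↔ ∀ γ ∈ F, γ v = 0 := fun v => by
    simp [N, Submodule.mem_iInf]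
  -- A Hahn-Banach extension `h` of `g|_N` has norm at most `ε`, and `g - h` kills `N`, hence lies
  -- in the span of `F`.
  obtain ⟨h, hhg, hh⟩ := exists_extension_norm_eq N (g.comp N.subtypeL)
  refine ⟨g - h, ?_, ?_⟩
  · have hker : N ≤ LinearMap.ker (g - h).toLinearMap := fun v hv => by
      have := hhg ⟨v, hv⟩
      simpa [sub_eq_zero] using this.symm
    have := mem_span_of_iInf_ker_le_ker hker
    obtain ⟨c, hc⟩ := (Submodule.mem_span_range_iff_exists_fun ℂ).1 this
    have hgh : g - h = ∑ γ : F, c γ • (γ : StrongDual ℂ E) := by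
      ext v
      have := LinearMap.congr_fun hc v
      simpa using this.symm
    rw [hgh]
    exact Submodule.sum_mem _ fun γ _ => Submodule.smul_mem _ _ (Submodule.subset_span γ.2)
  · rw [sub_sub_cancel, hh]
    refine ContinuousLinearMap.opNorm_le_bound _ hε fun v => ?_
    exact hg v ((hN v).1 v.2)

/-- The common kernel of finitely many functionals is the range of `1 - p` for a finite rank
operator `p`. -/
theorem exists_finite_rank_sub_apply_mem_ker (F : Finset (StrongDual ℂ E)) :
    ∃ p : E →L[ℂ] E, FiniteDimensional ℂ (LinearMap.range p.toLinearMap) ∧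
      ∀ x, ∀ γ ∈ F, γ (x - p x) = 0 := by
  let L : E →L[ℂ] (F → ℂ) := ContinuousLinearMap.pi fun γ => (γ : StrongDual ℂ E)
  obtain ⟨s, hs⟩ := L.toLinearMap.rangeRestrict.exists_rightInverse_of_surjective
    (LinearMap.range_rangeRestrict _)
  let L' : E →L[ℂ] LinearMap.range L.toLinearMap :=
    L.codRestrict _ fun x => LinearMap.mem_range_self _ x
  let p : E →L[ℂ] E := (LinearMap.toContinuousLinearMap s).comp L'
  refine ⟨p, ?_, fun x γ hγ => ?_⟩
  · have : LinearMap.range p.toLinearMap ≤ LinearMap.range s := by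
      rintro _ ⟨x, rfl⟩
      exact ⟨L' x, rfl⟩
    exact Submodule.finiteDimensional_of_le this
  · have h1 := LinearMap.congr_fun hs (L' x)
    have h2 : L (p x) = L x := congrArg Subtype.val h1
    have h3 := congrFun h2 ⟨γ, hγ⟩
    simp only [L, ContinuousLinearMap.pi_apply] at h3
    rw [map_sub, h3, sub_self]

theorem totallyBounded_of_finiteDimensional {X : Type*} [NormedAddCommGroup X] [NormedSpace ℂ X]
    (S : Submodule ℂ X) [FiniteDimensional ℂ S] {s : Set X} (hs : s ⊆ S)
    (hb : ∃ M, ∀ x ∈ s, ‖x‖ ≤ M) : TotallyBounded s := by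
  obtain ⟨M, hM⟩ := hb
  have : ProperSpace S := FiniteDimensional.proper ℂ S
  have h := (isCompact_closedBall (0 : S) M).totallyBounded.image S.subtypeL.uniformContinuous
  exact h.subset fun x hx => (Set.mem_image _ _ _).2 ⟨⟨x, hs hx⟩, by simpa using hM x hx, rfl⟩

/-- If all homogeneous polynomials are weakly continuous at zero on bounded sets, derivatives of
polynomials are compact. -/
theorem totallyBounded_fderiv_image
    (H : ∀ (k : ℕ) (A : ContinuousMultilinearMap ℂ (fun _ : Fin k => E) ℂ),
      WeaklyContinuousAtZero (diag A)) {n : ℕ} {f : E → ℂ} (hf : f ∈ polyLE E n) (R : ℝ) :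
    TotallyBounded (fderiv ℂ f '' Metric.closedBall 0 R) := by
  induction n generalizing f R with
  | zero =>
    have : f = fun _ => f 0 := funext fun x => eq_const_of_mem_polyLE_zero hf x
    rw [this]
    refine Set.Subsingleton.totallyBounded ?_
    rintro _ ⟨x, -, rfl⟩ _ ⟨y, -, rfl⟩
    simp
  | succ n ih =>
    have hdiff : ∀ {m : ℕ} {g : E → ℂ}, g ∈ polyLE E m → Differentiable ℂ g := fun hg =>
      (contDiff_of_mem_polyLE hg).differentiable (by simp)
    have hbd := exists_norm_le_of_mem_polyLE hf
    have hd2 : Differentiable ℂ (fderiv ℂ f) :=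
      ((contDiff_of_mem_polyLE hf).fderiv_right (m := 1) (by simp)).differentiable (by simp)
    refine totallyBounded_of_forall_exists_dist_lt fun ε hε => ?_
    rcases lt_or_ge R 0 with hR | hR
    · exact ⟨∅, totallyBounded_empty, by simp [Metric.closedBall_eq_empty.2 hR]⟩
    -- The radius is `2R + 1`, the bound for the points `u` below, plus `1` for a Cauchy estimate on
    -- a disc of radius one. Likewise `3R + 1` below bounds `u + a b`.
    obtain ⟨F, hF⟩ := weaklyContinuousAtZero_of_mem_polyLE H hf (2 * R + 2) (ε / 3) (by positivity)
    obtain ⟨p, hpfin, hpF⟩ := exists_finite_rank_sub_apply_mem_ker F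
    obtain ⟨C, hC⟩ := exists_norm_fderiv_le_of_bounded (hdiff hf) hbd (2 * R + 1)
    obtain ⟨M, hM0, hM⟩ := exists_norm_sub_le_of_bounded hd2
      (exists_norm_fderiv_le_of_bounded (hdiff hf) hbd) (3 * R + 1)
    let δ : ℝ := min 1 (ε / (3 * M))
    have hδ : 0 < δ := by positivity
    have hpb : TotallyBounded (p '' Metric.closedBall 0 R) := by
      refine totallyBounded_of_finiteDimensional (LinearMap.range p.toLinearMap) ?_ ⟨‖p‖ * R, ?_⟩
      · rintro _ ⟨x, -, rfl⟩
        exact LinearMap.mem_range_self _ x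
      · rintro _ ⟨x, hx, rfl⟩
        exact (p.le_opNorm x).trans (by gcongr; simpa using hx)
    obtain ⟨t, htsub, htfin, ht⟩ := Metric.finite_approx_of_totallyBounded hpb δ hδ
    have htsub' : ∀ b, b ∈ t → ∃ a, a ∈ Metric.closedBall (0 : E) R ∧ p a = b := fun b hb =>
      htsub hb
    choose! a haR hap using htsub'
    let W : Set (StrongDual ℂ E) :=
      {w | w ∈ Submodule.span ℂ (F : Set (StrongDual ℂ E)) ∧ ‖w‖ ≤ C + ε / 3}
    have hW : TotallyBounded W := by
      have : FiniteDimensional ℂ (Submodule.span ℂ (F : Set (StrongDual ℂ E))) :=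
        FiniteDimensional.span_finset ℂ F
      exact totallyBounded_of_finiteDimensional _ (fun w hw => hw.1) ⟨_, fun w hw => hw.2⟩
    refine ⟨⋃ b ∈ t, Set.image2 (· + ·) W
      (fderiv ℂ (fun x => f (x + a b) - f x) '' Metric.closedBall 0 (2 * R + 1)),
      (totallyBounded_biUnion htfin).2 fun b _ => hW.add_image2 (ih (sub_mem_polyLE hf (a b)) _), ?_⟩
    rintro _ ⟨x, hx, rfl⟩
    obtain ⟨b, hb, hxb⟩ := Set.mem_iUnion₂.1 (ht ⟨x, hx, rfl⟩)
    have hx' : ‖x‖ ≤ R := by simpa using hx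
    have ha' : ‖a b‖ ≤ R := by simpa using haR b hb
    have hpx : ‖p (x - a b)‖ < δ := by
      rw [map_sub, hap b hb, ← dist_eq_norm]
      exact hxb
    -- The point `x` differs from `u + a b` only by the small vector `p (x - a b)`. At `u`, in the
    -- common kernel of `F`, the derivative is nearly in the span of `F`; passing from `u` to `u + a
    -- b` adds the derivative of a difference of `f`, which has lower degree.
    let u : E := x - a b - p (x - a b)
    have huF : ∀ γ ∈ F, γ u = 0 := hpF _
    have hu : ‖u‖ ≤ 2 * R + 1 := by
      have h1 := norm_sub_le (x - a b) (p (x - a b))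
      have h2 := norm_sub_le x (a b)
      have h3 : δ ≤ 1 := min_le_left _ _
      linarith
    obtain ⟨w, hwF, hw⟩ := exists_mem_span_norm_sub_le F (fderiv ℂ f u) (ε := ε / 3)
      (by positivity) fun v hv => by
        rcases eq_or_ne v 0 with rfl | hv0
        · simp
        have hv' : 0 < ‖v‖ := norm_pos_iff.2 hv0
        have h := norm_fderiv_apply_le_of_forall_norm_eq (f := fun x => f x - f 0)
          ((hdiff hf).sub_const _) (x := u) (v := v) (r := 1 / ‖v‖) (M := ε / 3) (by positivity)
          fun s hs => hF _ ?_ fun γ hγ => by simp [huF γ hγ, hv γ hγ]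
        · rw [fderiv_sub_const] at h
          simpa using h
        · refine (norm_add_le _ _).trans ?_
          rw [norm_smul, hs, div_mul_cancel₀ _ hv'.ne']
          linarith
    refine ⟨w + fderiv ℂ (fun x => f (x + a b) - f x) u, Set.mem_biUnion hb
      (Set.mem_image2_of_mem ⟨hwF, ?_⟩ ⟨u, by simpa using hu, rfl⟩), ?_⟩
    · have h1 := norm_sub_norm_le w (fderiv ℂ f u)
      rw [norm_sub_rev] at h1
      linarith [hC u hu]
    · have h1 : fderiv ℂ (fun x => f (x + a b) - f x) u = fderiv ℂ f (u + a b) - fderiv ℂ f u := by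
        have hd : Differentiable ℂ f := hdiff hf
        rw [fderiv_fun_sub (by fun_prop) (hd u), fderiv_comp_add_right]
      have h2 : ‖fderiv ℂ f x - fderiv ℂ f (u + a b)‖ ≤ ε / 3 := by
        refine (hM x (u + a b) (by linarith) ?_).trans ?_
        · linarith [norm_add_le u (a b)]
        · have : x - (u + a b) = p (x - a b) := by simp only [u]; abel
          rw [this]
          calc M * ‖p (x - a b)‖ ≤ M * (ε / (3 * M)) := by
                gcongr
                exact hpx.le.trans (min_le_right _ _)
            _ = ε / 3 := by field_simp
      have h3 : fderiv ℂ f x - (w + fderiv ℂ (fun x => f (x + a b) - f x) u) =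
          (fderiv ℂ f x - fderiv ℂ f (u + a b)) + (fderiv ℂ f u - w) := by
        rw [h1]; abel
      rw [dist_eq_norm, h3]
      linarith [norm_add_le (fderiv ℂ f x - fderiv ℂ f (u + a b)) (fderiv ℂ f u - w)]

end Polynomials

/-! ### Approximation by finite type polynomials under the approximation property. -/

section FiniteType

variable {E : Type*} [NormedAddCommGroup E] [NormedSpace ℂ E]

/-- If a polynomial with vector coefficients takes values in a subspace, so do its coefficients. -/
theorem coeff_mem_of_forall_sum_pow_smul_mem {V : Type*} [AddCommGroup V] [Module ℂ V]
    (W : Submodule ℂ V) (N : ℕ) (c : ℕ → V)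
    (h : ∀ t : ℂ, ∑ m ∈ Finset.range N, t ^ m • c m ∈ W) {m : ℕ} (hm : m < N) : c m ∈ W := by
  by_contra hc
  -- A linear form killing `W` but not `c m` turns the hypothesis into a scalar polynomial that
  -- vanishes identically.
  obtain ⟨f, hf, hW⟩ := W.exists_le_ker_of_notMem hc
  let p : Polynomial ℂ := ∑ m ∈ Finset.range N, Polynomial.C (f (c m)) * Polynomial.X ^ m
  have hp : p = 0 := Polynomial.funext fun t => by
    have := hW (h t)
    rw [LinearMap.mem_ker, map_sum] at this
    simp only [map_smul, smul_eq_mul] at this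
    simp only [p, Polynomial.eval_finsetSum, Polynomial.eval_mul, Polynomial.eval_C,
      Polynomial.eval_pow, Polynomial.eval_X, Polynomial.eval_zero, ← this]
    exact Finset.sum_congr rfl fun _ _ => mul_comm _ _
  have hcoeff : p.coeff m = f (c m) := by
    simp [p, Polynomial.coeff_C_mul, Polynomial.coeff_X_pow, hm]
  rw [hp, Polynomial.coeff_zero] at hcoeff
  exact hf hcoeff.symm

/-- Polarization: `γ ηⁿ` is, up to the factor `n + 1`, the coefficient of `t` in `(tγ + η)ⁿ⁺¹`,
which is of finite type for every `t`. -/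
theorem ofDual_mul_mem_finiteTypePolynomials (γ : StrongDual ℂ E)
    {g : Hb (Set.univ : Set E)} (hg : g ∈ finiteTypePolynomials E) :
    Hb.ofDual Set.univ γ * g ∈ finiteTypePolynomials E := by
  induction hg using Submodule.span_induction with
  | mem g hg =>
    obtain ⟨η, n, rfl⟩ := hg
    have h := coeff_mem_of_forall_sum_pow_smul_mem (finiteTypePolynomials E) (n + 2)
      (fun m => ((n + 1).choose m : ℂ) •
        (Hb.ofDual Set.univ γ ^ m * Hb.ofDual Set.univ η ^ (n + 1 - m))) (fun t => by
        have h1 : Hb.ofDual Set.univ (t • γ + η) ^ (n + 1) ∈ finiteTypePolynomials E :=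
          Submodule.subset_span ⟨_, _, rfl⟩
        have h2 : Hb.ofDual Set.univ (t • γ + η) =
          t • Hb.ofDual Set.univ γ + Hb.ofDual Set.univ η := rfl
        rw [h2, add_pow] at h1
        convert h1 using 2 with m
        rw [smul_pow, smul_mul_assoc, smul_mul_assoc, mul_comm _ (Nat.cast _ : Hb _),
          ← nsmul_eq_mul, Nat.cast_smul_eq_nsmul]) (m := 1) (by omega)
    have h3 := (finiteTypePolynomials E).smul_mem ((n + 1 : ℂ)⁻¹) h
    have hn : (n + 1 : ℂ) ≠ 0 := by exact_mod_cast n.succ_ne_zero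
    simpa [smul_smul, inv_mul_cancel₀ hn] using h3
  | zero => simp
  | add f g _ _ hf hg => rw [mul_add]; exact Submodule.add_mem _ hf hg
  | smul c f _ hf => rw [mul_smul_comm]; exact Submodule.smul_mem _ _ hf

/-- A function on `E` that is a limit of finite type polynomials, uniformly on bounded sets. -/
def FiniteTypeApproximable (f : E → ℂ) : Prop :=
  ∀ R : ℝ, ∀ ε > 0, ∃ g ∈ finiteTypePolynomials E, ∀ x, ‖x‖ ≤ R →
    ‖f x - g ⟨x, Set.mem_univ x⟩‖ ≤ ε

namespace FiniteTypeApproximable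

theorem const (c : ℂ) : FiniteTypeApproximable (fun _ : E => c) := fun R ε hε => by
  refine ⟨c • Hb.ofDual Set.univ 0 ^ 0, Submodule.smul_mem _ _ (Submodule.subset_span ⟨_, _, rfl⟩),
    fun x _ => ?_⟩
  have h : (c • Hb.ofDual Set.univ (0 : StrongDual ℂ E) ^ 0) ⟨x, Set.mem_univ x⟩ = c * 1 := rfl
  rw [h, mul_one, sub_self, norm_zero]
  exact hε.le

theorem add {f g : E → ℂ} (hf : FiniteTypeApproximable f) (hg : FiniteTypeApproximable g) :
    FiniteTypeApproximable (fun x => f x + g x) := fun R ε hε => by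
  obtain ⟨p, hp, hfp⟩ := hf R (ε / 2) (by positivity)
  obtain ⟨q, hq, hgq⟩ := hg R (ε / 2) (by positivity)
  refine ⟨p + q, Submodule.add_mem _ hp hq, fun x hx => ?_⟩
  have h : (p + q) ⟨x, Set.mem_univ x⟩ = p ⟨x, Set.mem_univ x⟩ + q ⟨x, Set.mem_univ x⟩ := rfl
  rw [h, add_sub_add_comm]
  exact (norm_add_le _ _).trans (by linarith [hfp x hx, hgq x hx])

theorem sum {ι : Type*} (s : Finset ι) {f : ι → E → ℂ}
    (hf : ∀ i ∈ s, FiniteTypeApproximable (f i)) :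
    FiniteTypeApproximable (fun x => ∑ i ∈ s, f i x) := by
  classical
  induction s using Finset.induction_on with
  | empty => simpa using const 0
  | insert i s hi ih =>
    simp only [Finset.sum_insert hi]
    exact (hf i (by simp)).add (ih fun j hj => hf j (by simp [hj]))

theorem dual_mul (γ : StrongDual ℂ E) {f : E → ℂ} (hf : FiniteTypeApproximable f) :
    FiniteTypeApproximable (fun x => γ x * f x) := fun R ε hε => by
  obtain ⟨p, hp, hfp⟩ := hf R (ε / (‖γ‖ * |R| + 1)) (by positivity)
  refine ⟨Hb.ofDual Set.univ γ * p, ofDual_mul_mem_finiteTypePolynomials γ hp, fun x hx => ?_⟩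
  have h : (Hb.ofDual Set.univ γ * p) ⟨x, Set.mem_univ x⟩ = γ x * p ⟨x, Set.mem_univ x⟩ := rfl
  rw [h, ← mul_sub, norm_mul]
  have h1 : ‖γ x‖ ≤ ‖γ‖ * |R| + 1 := by
    have := γ.le_of_opNorm_le_of_le le_rfl (hx.trans (le_abs_self R))
    linarith
  calc _ ≤ (‖γ‖ * |R| + 1) * (ε / (‖γ‖ * |R| + 1)) := by
        gcongr
        exact hfp x hx
    _ = ε := by field_simp

theorem of_forall_approx {f : E → ℂ} (h : ∀ R : ℝ, ∀ ε > 0, ∃ g : E → ℂ,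
    FiniteTypeApproximable g ∧ ∀ x, ‖x‖ ≤ R → ‖f x - g x‖ ≤ ε) : FiniteTypeApproximable f :=
  fun R ε hε => by
    obtain ⟨g, hg, hfg⟩ := h R (ε / 2) (by positivity)
    obtain ⟨p, hp, hgp⟩ := hg R (ε / 2) (by positivity)
    refine ⟨p, hp, fun x hx => ?_⟩
    linarith [norm_sub_le_norm_sub_add_norm_sub (f x) (g x) (p ⟨x, Set.mem_univ x⟩), hfg x hx,
      hgp x hx]

end FiniteTypeApproximable

/-- Symmetric continuous multilinear forms. -/
def IsSymmetricForm {n : ℕ} (A : ContinuousMultilinearMap ℂ (fun _ : Fin n => E) ℂ) : Prop :=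
  ∀ (σ : Equiv.Perm (Fin n)) (v : Fin n → E), A (v ∘ σ) = A v

/-- The map `(x₁, …, xₙ) ↦ A (·, x₁, …, xₙ)` with values in the dual. -/
noncomputable def dualForm {n : ℕ} (A : ContinuousMultilinearMap ℂ (fun _ : Fin (n + 1) => E) ℂ) :
    ContinuousMultilinearMap ℂ (fun _ : Fin n => E) (StrongDual ℂ E) :=
  A.curryLeft.flipMultilinear

variable {n : ℕ} {A : ContinuousMultilinearMap ℂ (fun _ : Fin (n + 1) => E) ℂ}

theorem dualForm_apply (v : Fin n → E) (x : E) : dualForm A v x = A (Fin.cons x v) := rfl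

theorem dualForm_const_self (x : E) : dualForm A (fun _ => x) x = diag A x := by
  rw [dualForm_apply, diag]
  exact congrArg A (funext fun i => by refine Fin.cases ?_ (fun j => ?_) i <;> simp)

theorem IsSymmetricForm.dualForm_comp_perm (hA : IsSymmetricForm A) (σ : Equiv.Perm (Fin n))
    (v : Fin n → E) : dualForm A (v ∘ σ) = dualForm A v := by
  ext x
  rw [dualForm_apply, dualForm_apply, ← hA (Equiv.Perm.decomposeFin.symm (0, σ)) (Fin.cons x v)]
  refine congrArg A (funext fun i => ?_)
  refine Fin.cases ?_ (fun j => ?_) i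
  · simp
  · simp [Equiv.Perm.decomposeFin_symm_apply_succ]

theorem IsSymmetricForm.fderiv_diag (hA : IsSymmetricForm A) (x : E) :
    fderiv ℂ (diag A) x = ((n + 1 : ℕ) : ℂ) • dualForm A (fun _ => x) := by
  have h : HasFDerivAt (diag A) ((A.linearDeriv fun _ => x).comp
      (ContinuousLinearMap.pi fun _ => ContinuousLinearMap.id ℂ E)) x :=
    (A.hasFDerivAt fun _ => x).comp x
      (ContinuousLinearMap.pi fun _ : Fin (n + 1) => ContinuousLinearMap.id ℂ E).hasFDerivAt
  rw [h.fderiv]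
  ext v
  have h1 : ∀ i : Fin (n + 1), A (Function.update (fun _ => x) i v) = A (Fin.cons v fun _ => x) := by
    intro i
    rw [← hA (Equiv.swap 0 i)]
    refine congrArg A (funext fun j => ?_)
    refine Fin.cases ?_ (fun k => ?_) j
    · simp
    · simp only [Function.comp_apply, Fin.cons_succ]
      refine Function.update_of_ne (fun hk => ?_) _ _
      rw [Equiv.swap_apply_eq_iff, Equiv.swap_apply_right] at hk
      exact Fin.succ_ne_zero k hk
  simp [ContinuousMultilinearMap.linearDeriv_apply, dualForm_apply, h1]

/-- For symmetric `A` the derivative of the diagonal is `(n + 1) A(·, x, …, x)`, so its compactness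
passes to `dualForm` after rescaling. -/
theorem totallyBounded_dualForm_image
    (H : ∀ (k : ℕ) (A : ContinuousMultilinearMap ℂ (fun _ : Fin k => E) ℂ),
      WeaklyContinuousAtZero (diag A)) (hA : IsSymmetricForm A) (R : ℝ) :
    TotallyBounded ((fun x => dualForm A fun _ => x) '' Metric.closedBall 0 R) := by
  have h := (totallyBounded_fderiv_image H (diag_mem_polyLE le_rfl A) R).image
    (uniformContinuous_const_smul (((n + 1 : ℕ) : ℂ)⁻¹))
  rw [Set.image_image] at h
  convert h using 3 with x
  rw [hA.fderiv_diag, smul_smul, inv_mul_cancel₀ (by exact_mod_cast n.succ_ne_zero), one_smul]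

/-- With the approximation property of the dual, symmetric forms are limits of finite type
polynomials as soon as homogeneous polynomials are weakly continuous at zero on bounded sets. -/
theorem IsSymmetricForm.finiteTypeApproximable
    (hE : HasApproximationProperty (StrongDual ℂ E))
    (H : ∀ (k : ℕ) (A : ContinuousMultilinearMap ℂ (fun _ : Fin k => E) ℂ),
      WeaklyContinuousAtZero (diag A)) {n : ℕ}
    {A : ContinuousMultilinearMap ℂ (fun _ : Fin n => E) ℂ} (hA : IsSymmetricForm A) :
    FiniteTypeApproximable (diag A) := by
  induction n with
  | zero =>
    have : diag A = fun _ => diag A 0 := funext fun x => congrArg A (Subsingleton.elim _ _)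
    rw [this]
    exact .const _
  | succ n ih =>
    refine .of_forall_approx fun R ε hε => ?_
    obtain ⟨T, hT, hTA⟩ := hE _
      ((totallyBounded_dualForm_image H hA R).closure.isCompact_of_isClosed isClosed_closure)
      (ε / (|R| + 1)) (by positivity)
    let b := Module.finBasis ℂ T.range
    let T' : StrongDual ℂ E →L[ℂ] T.range := T.codRestrict _ fun x => LinearMap.mem_range_self _ x
    let z : ∀ j, StrongDual ℂ (StrongDual ℂ E) := fun j =>
      (LinearMap.toContinuousLinearMap (b.coord j)).comp T'
    -- Applied to `A(·, x, …, x)` and then evaluated at `x`, this splits off the functionals `b j`;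
    -- the remaining factors are diagonals of the symmetric `n`-linear forms `z j ∘ dualForm A`.
    have hTz : ∀ γ : StrongDual ℂ E, T γ = ∑ j, z j γ • (b j : StrongDual ℂ E) := fun γ => by
      have := congrArg Subtype.val (b.sum_repr (T' γ))
      rw [← show ((T' γ : T.range) : StrongDual ℂ E) = T γ from rfl, ← this,
        Submodule.coe_sum]
      rfl
    refine ⟨fun x => ∑ j, (b j : StrongDual ℂ E) x *
      diag ((z j).compContinuousMultilinearMap (dualForm A)) x, ?_, fun x hx => ?_⟩
    · refine .sum _ fun j _ => .dual_mul _ (ih fun σ v => ?_)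
      exact congrArg (z j) (hA.dualForm_comp_perm σ v)
    · have h1 := hTA (dualForm A fun _ => x)
        (subset_closure ⟨x, by simpa using hx, rfl⟩)
      have h2 : ∑ j, (b j : StrongDual ℂ E) x *
          diag ((z j).compContinuousMultilinearMap (dualForm A)) x =
          T (dualForm A fun _ => x) x := by
        rw [hTz]
        simp [diag, mul_comm]
      rw [show (fun x => ∑ j, (b j : StrongDual ℂ E) x *
        diag ((z j).compContinuousMultilinearMap (dualForm A)) x) x = _ from h2, ← dualForm_const_self,
        norm_sub_rev, ← sub_apply]
      calc _ ≤ (ε / (|R| + 1)) * (|R| + 1) :=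
            ContinuousLinearMap.le_of_opNorm_le_of_le _ h1.le (by linarith [le_abs_self R])
        _ = ε := by field_simp

end FiniteType

theorem HasSum.congr_of_eq {f g : ℕ → ℂ} {a : ℂ} (h : HasSum f a) (hfg : ∀ n, g n = f n) :
    HasSum g a :=
  (funext hfg : g = f) ▸ h

/-! ### Taylor expansions in `H_b(E)` and the density criterion. -/

section BoundedType

variable {E : Type*} [NormedAddCommGroup E] [NormedSpace ℂ E]

namespace Hb

theorem tendsto_nhds_iff {U : Set E} {ι : Type*} {p : Filter ι} {F : ι → Hb U} {f : Hb U} :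
    Filter.Tendsto F p (𝓝 f) ↔
      ∀ A : Set U, IsUBounded U A → TendstoUniformlyOn (fun i x => F i x) (fun x => f x) p A := by
  rw [nhds_induced, Filter.tendsto_comap_iff, UniformOnFun.tendsto_iff_tendstoUniformlyOn]
  rfl

theorem continuous_restrict {U V : Set E} (h : V ⊆ U) : Continuous (restrict h) := by
  refine continuous_iff_continuousAt.2 fun f => tendsto_nhds_iff.2 fun A hA => ?_
  have hA' : IsUBounded U (Set.inclusion h '' A) := by
    obtain ⟨hb, ε, hε, hball⟩ := hA
    refine ⟨by rwa [Set.image_image], ε, hε, ?_⟩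
    rintro _ ⟨x, hx, rfl⟩
    exact (hball x hx).trans h
  have := tendsto_nhds_iff.1 (Filter.tendsto_id (x := 𝓝 f)) _ hA'
  rw [Metric.tendstoUniformlyOn_iff] at this ⊢
  intro ε hε
  filter_upwards [this ε hε] with g hg x hx
  exact hg _ ⟨x, hx, rfl⟩

/-- A function in `H_b(E)` as a function on `E`. -/
def entire (f : Hb (Set.univ : Set E)) (x : E) : ℂ := f ⟨x, Set.mem_univ x⟩

theorem contDiff_entire (f : Hb (Set.univ : Set E)) {m : WithTop ℕ∞} : ContDiff ℂ m f.entire := by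
  obtain ⟨⟨g, hg, hgf⟩, -⟩ := f.2
  have : f.entire = g := funext fun x => (hgf ⟨x, Set.mem_univ x⟩).symm
  rw [this]
  exact contDiffOn_univ.1 (hg.contDiffOn uniqueDiffOn_univ)

omit [NormedSpace ℂ E] in
theorem isUBounded_univ {A : Set (Set.univ : Set E)} {R : ℝ} (h : ∀ x ∈ A, ‖(x : E)‖ ≤ R) :
    IsUBounded Set.univ A := by
  refine ⟨isBounded_iff_forall_norm_le.2 ⟨R, ?_⟩, 1, one_pos, fun x _ => Set.subset_univ _⟩
  rintro _ ⟨x, hx, rfl⟩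
  exact h x hx

theorem exists_norm_entire_le (f : Hb (Set.univ : Set E)) (R : ℝ) :
    ∃ M, ∀ x, ‖x‖ ≤ R → ‖f.entire x‖ ≤ M := by
  obtain ⟨M, hM⟩ := (f.2.2 {x | ‖(x : E)‖ ≤ R} (isUBounded_univ fun x hx => hx)).exists_norm_le
  exact ⟨M, fun x hx => hM _ ⟨⟨x, Set.mem_univ x⟩, hx, rfl⟩⟩

end Hb

theorem taylorForm_eq (f : Hb (Set.univ : Set E)) (n : ℕ) :
    taylorForm f n = ((n.factorial : ℂ)⁻¹) • iteratedFDeriv ℂ n f.entire 0 := rfl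

theorem isSymmetricForm_taylorForm (f : Hb (Set.univ : Set E)) (n : ℕ) :
    IsSymmetricForm (taylorForm f n) := fun σ v => by
  rw [taylorForm_eq, smul_apply, smul_apply,
    f.contDiff_entire.contDiffAt.iteratedFDeriv_comp_perm]

/-- The `n`-th Taylor form depends linearly on the function. -/
noncomputable def taylorFormL (E : Type*) [NormedAddCommGroup E] [NormedSpace ℂ E] (n : ℕ) :
    Hb (Set.univ : Set E) →ₗ[ℂ] ContinuousMultilinearMap ℂ (fun _ : Fin n => E) ℂ where
  toFun f := taylorForm f n
  map_add' f g := by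
    simp only [taylorForm_eq]
    rw [show (f + g).entire = f.entire + g.entire from rfl,
      iteratedFDeriv_add f.contDiff_entire g.contDiff_entire]
    exact smul_add _ _ _
  map_smul' c f := by
    simp only [taylorForm_eq, RingHom.id_apply]
    rw [show (c • f).entire = c • f.entire from rfl,
      iteratedFDeriv_const_smul_apply f.contDiff_entire.contDiffAt]
    exact smul_comm _ _ _

/-- Cauchy estimate for the Taylor coefficients. -/
theorem norm_taylorForm_le (f : Hb (Set.univ : Set E)) {r M : ℝ} (hr : 0 < r)
    (hM : ∀ x, ‖x‖ ≤ r → ‖f.entire x‖ ≤ M) (n : ℕ) :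
    ‖taylorForm f n‖ ≤ M * (Real.exp 1 / r) ^ n := by
  have hM0 : 0 ≤ M := (norm_nonneg _).trans (hM 0 (by simpa using hr.le))
  rcases Nat.eq_zero_or_pos n with rfl | hn
  · rw [taylorForm_eq, norm_smul]
    simpa using hM 0 (by simpa using hr.le)
  have hn' : (0 : ℝ) < n := by exact_mod_cast hn
  -- The iterated estimate takes `n` steps of length `r / n`; this costs `nⁿ / n! ≤ eⁿ`, harmless
  -- because `r` is arbitrary.
  have h := norm_iteratedFDeriv_le_of_forall_mem_closedBall f.contDiff_entire (r := r / n)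
    (M := M) (by positivity) n (x := 0) fun y hy => hM y (by
      rw [mul_div_cancel₀ _ hn'.ne'] at hy
      simpa using hy)
  rw [taylorForm_eq, norm_smul, norm_inv, Complex.norm_natCast]
  have hfac : (0 : ℝ) < n.factorial := by exact_mod_cast n.factorial_pos
  calc _ ≤ (n.factorial : ℝ)⁻¹ * (M / (r / n) ^ n) := by gcongr
    _ = M * ((n : ℝ) ^ n / n.factorial) / r ^ n := by rw [div_pow]; field_simp
    _ ≤ M * Real.exp n / r ^ n := by
        gcongr
        exact Real.pow_div_factorial_le_exp _ hn'.le n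
    _ = _ := by rw [div_pow, ← Real.exp_nat_mul, mul_one, mul_div_assoc]

/-- This is the one-variable Taylor series of the entire function `t ↦ f(t x)` at `t = 1`. -/
theorem hasSum_diag_taylorForm (f : Hb (Set.univ : Set E)) (x : E) :
    HasSum (fun n => diag (taylorForm f n) x) (f.entire x) := by
  let L : ℂ →L[ℂ] E := ContinuousLinearMap.toSpanSingleton ℂ x
  have hd : Differentiable ℂ (f.entire ∘ L) :=
    (f.contDiff_entire.differentiable (n := 1) (by simp)).comp L.differentiable
  have h := Complex.hasSum_taylorSeries_of_entire hd 0 1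
  have hL : (f.entire ∘ L) 1 = f.entire x := by simp [L]
  rw [hL] at h
  refine h.congr_of_eq fun n => ?_
  rw [iteratedDeriv_eq_iteratedFDeriv,
    L.iteratedFDeriv_comp_right (n := n) f.contDiff_entire 0 le_rfl]
  simp [diag, taylorForm_eq, L]

theorem norm_diag_taylorForm_le (f : Hb (Set.univ : Set E)) (R : ℝ) :
    ∃ M, ∀ (n : ℕ) (x : E), ‖x‖ ≤ R → ‖diag (taylorForm f n) x‖ ≤ M * (1 / 2) ^ n := by
  -- Chosen so that `(e / r) (|R| + 1) = 1 / 2`.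
  let r := 2 * Real.exp 1 * (|R| + 1)
  have hr : 0 < r := by positivity
  obtain ⟨M, hM⟩ := f.exists_norm_entire_le r
  have hM0 : 0 ≤ M := (norm_nonneg _).trans (hM 0 (by simpa using hr.le))
  refine ⟨M, fun n x hx => (norm_diag_le _ x).trans ?_⟩
  have hx' : ‖x‖ ≤ |R| + 1 := by linarith [le_abs_self R]
  calc _ ≤ (M * (Real.exp 1 / r) ^ n) * (|R| + 1) ^ n := by
        gcongr
        exact norm_taylorForm_le f hr hM n
    _ = M * (1 / 2) ^ n := by
        rw [mul_assoc, ← mul_pow]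
        congr 2
        simp only [r]
        field_simp

theorem finiteTypeApproximable_entire (f : Hb (Set.univ : Set E))
    (h : ∀ n, FiniteTypeApproximable (diag (taylorForm f n))) :
    FiniteTypeApproximable f.entire := by
  refine .of_forall_approx fun R ε hε => ?_
  obtain ⟨M, hM⟩ := norm_diag_taylorForm_le f R
  have hlim : Filter.Tendsto (fun N : ℕ => M * (1 / 2 : ℝ) ^ N / (1 - 1 / 2)) Filter.atTop (𝓝 0) := by
    simpa using ((tendsto_pow_atTop_nhds_zero_of_lt_one (r := (1 / 2 : ℝ)) (by norm_num)
      (by norm_num)).const_mul M).div_const (1 - 1 / 2)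
  obtain ⟨N, hN⟩ := (hlim.eventually (gt_mem_nhds hε)).exists
  refine ⟨fun x => ∑ n ∈ Finset.range N, diag (taylorForm f n) x, .sum _ fun n _ => h n,
    fun x hx => ?_⟩
  rw [norm_sub_rev]
  exact (norm_sub_le_of_geometric_bound_of_hasSum (by norm_num) (fun n => hM n x hx)
    (hasSum_diag_taylorForm f x) N).trans hN.le

theorem dense_finiteTypePolynomials (h : ∀ f : Hb (Set.univ : Set E),
    FiniteTypeApproximable f.entire) :
    Dense (finiteTypePolynomials E : Set (Hb (Set.univ : Set E))) := by
  intro f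
  -- The `k`-th approximant works on the ball of radius `k`, and every bounded set lies in such a
  -- ball, so one sequence converges in `H_b(E)`.
  choose g hg hfg using fun k : ℕ => h f k (1 / ((k : ℝ) + 1)) (by positivity)
  refine mem_closure_of_tendsto (f := g) (b := Filter.atTop) (Hb.tendsto_nhds_iff.2 fun A hA => ?_)
    (Filter.Eventually.of_forall hg)
  obtain ⟨R, hR⟩ := hA.1.exists_norm_le
  rw [Metric.tendstoUniformlyOn_iff]
  intro ε hε
  obtain ⟨k₀, hk₀⟩ := exists_nat_ge R
  filter_upwards [(tendsto_one_div_add_atTop_nhds_zero_nat (𝕜 := ℝ)).eventually (gt_mem_nhds hε),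
    Filter.eventually_ge_atTop k₀] with k hk hk' x hx
  rw [dist_eq_norm]
  refine (hfg k x ?_).trans_lt hk
  calc ‖(x : E)‖ ≤ R := hR _ ⟨x, hx, rfl⟩
    _ ≤ k₀ := hk₀
    _ ≤ k := by exact_mod_cast hk'

end BoundedType

/-! ### Aron-Berner values and their relation to characters. -/

section AronBerner

variable {E : Type*} [NormedAddCommGroup E] [NormedSpace ℂ E]

theorem multilinearBidualExt_succ_apply (n : ℕ) (z : StrongDual ℂ (StrongDual ℂ E))
    (A : ContinuousMultilinearMap ℂ (fun _ : Fin (n + 1) => E) ℂ) :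
    multilinearBidualExt (n + 1) (fun _ => z) A =
      z ((multilinearBidualExt n fun _ => z).comp A.curryLeft) := rfl

theorem norm_multilinearBidualExt_le (n : ℕ) (z : StrongDual ℂ (StrongDual ℂ E))
    (A : ContinuousMultilinearMap ℂ (fun _ : Fin n => E) ℂ) :
    ‖multilinearBidualExt n (fun _ => z) A‖ ≤ ‖z‖ ^ n * ‖A‖ := by
  induction n with
  | zero =>
    simp [multilinearBidualExt]
  | succ n ih =>
    rw [multilinearBidualExt_succ_apply, pow_succ', mul_assoc]
    refine (z.le_opNorm _).trans (mul_le_mul_of_nonneg_left ?_ (norm_nonneg _))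
    refine ContinuousLinearMap.opNorm_le_bound _ (by positivity) fun x => ?_
    refine (ih _).trans ?_
    rw [mul_assoc]
    gcongr
    refine (A.curryLeft.le_opNorm x).trans_eq ?_
    rw [ContinuousMultilinearMap.curryLeft_norm]

theorem multilinearBidualExt_inclusion (n : ℕ) (a : E)
    (A : ContinuousMultilinearMap ℂ (fun _ : Fin n => E) ℂ) :
    multilinearBidualExt n (fun _ => NormedSpace.inclusionInDoubleDual ℂ E a) A = diag A a := by
  induction n with
  | zero => exact congrArg A (Subsingleton.elim _ _)
  | succ n ih =>
    rw [multilinearBidualExt_succ_apply, NormedSpace.dual_def, ContinuousLinearMap.comp_apply, ih]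
    exact dualForm_const_self a

/-- Freezing the first argument at `x` leaves a form of the same shape with `c γ(x)` in place of
`c`, so each step of the recursion contributes one factor `z γ`. -/
theorem multilinearBidualExt_eq_mul_pow (n : ℕ) (z : StrongDual ℂ (StrongDual ℂ E))
    (γ : StrongDual ℂ E) (c : ℂ) (A : ContinuousMultilinearMap ℂ (fun _ : Fin n => E) ℂ)
    (hA : ∀ v, A v = c * ∏ i, γ (v i)) :
    multilinearBidualExt n (fun _ => z) A = c * z γ ^ n := by
  induction n generalizing c with
  | zero =>
    simp [multilinearBidualExt, hA]
  | succ n ih =>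
    have h : (multilinearBidualExt n fun _ => z).comp A.curryLeft = (c * z γ ^ n) • γ := by
      ext x
      rw [ContinuousLinearMap.comp_apply, ih (c * γ x) _ fun v => ?_]
      · simp only [smul_apply, smul_eq_mul]
        ring
      · rw [ContinuousMultilinearMap.curryLeft_apply, hA, Fin.prod_univ_succ]
        simp [mul_assoc]
    rw [multilinearBidualExt_succ_apply, h, map_smul, smul_eq_mul, pow_succ]
    ring

theorem taylorForm_ofDual_pow_apply (γ : StrongDual ℂ E) (m n : ℕ) (v : Fin n → E) :
    taylorForm (Hb.ofDual Set.univ γ ^ m) n v = (if n = m then 1 else 0) * ∏ i, γ (v i) := by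
  have h : (Hb.ofDual Set.univ γ ^ m).entire = (fun t : ℂ => t ^ m) ∘ γ := rfl
  rw [taylorForm_eq, h, γ.iteratedFDeriv_comp_right (n := n) (f := fun t : ℂ => t ^ m)
    (contDiff_id.pow m) 0 le_rfl]
  have hn : (n.factorial : ℂ) ≠ 0 := by exact_mod_cast n.factorial_ne_zero
  simp only [smul_apply,
    ContinuousMultilinearMap.compContinuousLinearMap_apply,
    iteratedFDeriv_apply_eq_iteratedDeriv_mul_prod, map_zero, iteratedDeriv_fun_pow_zero]
  split_ifs with hnm
  · subst hnm
    simp [mul_comm, hn]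
  · simp

theorem hasAronBernerValue_ofDual_pow (z : StrongDual ℂ (StrongDual ℂ E)) (γ : StrongDual ℂ E)
    (m : ℕ) : HasAronBernerValue (Hb.ofDual Set.univ γ ^ m) z (z γ ^ m) := by
  have h : ∀ n, multilinearBidualExt n (fun _ => z) (taylorForm (Hb.ofDual Set.univ γ ^ m) n) =
      (if n = m then 1 else 0) * z γ ^ n := fun n =>
    multilinearBidualExt_eq_mul_pow n z γ _ _ (taylorForm_ofDual_pow_apply γ m n)
  simp only [HasAronBernerValue, h]
  convert hasSum_single m fun n hn => ?_ using 1
  · simp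
  · simp [hn]

theorem hasAronBernerValue_inclusion (f : Hb (Set.univ : Set E)) (a : E) :
    HasAronBernerValue f (NormedSpace.inclusionInDoubleDual ℂ E a) (f.entire a) := by
  simp only [HasAronBernerValue, multilinearBidualExt_inclusion]
  exact hasSum_diag_taylorForm f a

theorem norm_multilinearBidualExt_taylorForm_le (z : StrongDual ℂ (StrongDual ℂ E))
    (f : Hb (Set.univ : Set E)) {M : ℝ}
    (hM : ∀ x, ‖x‖ ≤ 2 * Real.exp 1 * (‖z‖ + 1) → ‖f.entire x‖ ≤ M) (n : ℕ) :
    ‖multilinearBidualExt n (fun _ => z) (taylorForm f n)‖ ≤ M * (1 / 2) ^ n := by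
  have hM0 : 0 ≤ M := (norm_nonneg _).trans (hM 0 (by rw [norm_zero]; positivity))
  calc _ ≤ (‖z‖ + 1) ^ n * (M * (Real.exp 1 / (2 * Real.exp 1 * (‖z‖ + 1))) ^ n) := by
        refine (norm_multilinearBidualExt_le n z _).trans ?_
        gcongr
        · linarith
        · exact norm_taylorForm_le f (by positivity) hM n
    _ = M * (1 / 2) ^ n := by
        rw [mul_left_comm, ← mul_pow]
        congr 2
        field_simp

/-- The Aron-Berner extension to a point of the bidual is a continuous functional on `H_b(E)`. -/
theorem exists_continuous_hasAronBernerValue (z : StrongDual ℂ (StrongDual ℂ E)) :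
    ∃ Φ : Hb (Set.univ : Set E) → ℂ, Continuous Φ ∧ ∀ f, HasAronBernerValue f z (Φ f) := by
  have hsum : ∀ f : Hb (Set.univ : Set E), ∃ w, HasAronBernerValue f z w := fun f => by
    obtain ⟨M, hM⟩ := f.exists_norm_entire_le (2 * Real.exp 1 * (‖z‖ + 1))
    exact Summable.of_norm_bounded
      ((summable_geometric_of_lt_one (r := (1 / 2 : ℝ)) (by norm_num) (by norm_num)).mul_left M)
      (norm_multilinearBidualExt_taylorForm_le z f hM)
  choose Φ hΦ using hsum
  refine ⟨Φ, continuous_iff_continuousAt.2 fun f => ?_, hΦ⟩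
  refine Metric.tendsto_nhds.2 fun ε hε => ?_
  have h := Hb.tendsto_nhds_iff.1 (Filter.tendsto_id (x := 𝓝 f))
    {x | ‖(x : E)‖ ≤ 2 * Real.exp 1 * (‖z‖ + 1)} (Hb.isUBounded_univ fun x hx => hx)
  rw [Metric.tendstoUniformlyOn_iff] at h
  filter_upwards [h (ε / 4) (by positivity)] with g hg
  have hgf : HasAronBernerValue (g - f) z (Φ g - Φ f) := by
    refine ((hΦ g).sub (hΦ f)).congr_of_eq fun n => ?_
    rw [show taylorForm (g - f) n = taylorForm g n - taylorForm f n from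
      map_sub (taylorFormL E n) g f, map_sub]
  -- With the bound `ε / 4` for `g - f` on a ball, the geometric series gives a total of at most `ε
  -- / 2`.
  have hb := norm_sub_le_of_geometric_bound_of_hasSum (r := 1 / 2) (by norm_num)
    (norm_multilinearBidualExt_taylorForm_le z (g - f) (M := ε / 4) fun x hx => by
      have := (hg ⟨x, Set.mem_univ x⟩ hx).le
      rw [dist_comm, dist_eq_norm] at this
      exact this) hgf 0
  rw [dist_eq_norm]
  rw [Finset.range_zero, Finset.sum_empty, zero_sub, norm_neg] at hb
  norm_num at hb
  linarith

/-- Tested on a functional `γ`, the defining identity reads `φ(γ|_U) = z(γ)`, that is `π(φ) = z`. -/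
theorem evaluationPoints_subset (U : Set E) :
    evaluationPoints U ⊆ Set.range (spectrumProj U) := by
  rintro z ⟨φ, hφ⟩
  refine ⟨φ, ContinuousLinearMap.ext fun γ => ?_⟩
  have h1 := hasAronBernerValue_ofDual_pow z γ 1
  have h2 := hφ (Hb.ofDual Set.univ γ ^ 1)
  have h3 := HasSum.unique h1 h2
  rw [pow_one, pow_one] at h3
  exact h3.symm

theorem map_pow_of_character {U : Set E} (φ : Mb U) (f : Hb U) (n : ℕ) :
    φ (f ^ n) = φ f ^ n := map_pow (WeakDual.CharacterSpace.toAlgHom φ) f n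

/-- If finite type polynomials are dense in `H_b(E)`, the spectrum of `H_b(U)` projects onto
evaluation points. -/
theorem range_spectrumProj_subset
    (hd : Dense (finiteTypePolynomials E : Set (Hb (Set.univ : Set E)))) (U : Set E) :
    Set.range (spectrumProj U) ⊆ evaluationPoints U := by
  rintro _ ⟨φ, rfl⟩
  obtain ⟨Φ, hΦ, hΦv⟩ := exists_continuous_hasAronBernerValue (spectrumProj U φ)
  refine ⟨φ, fun f => ?_⟩
  have hc : Continuous fun f => φ (Hb.restrict (Set.subset_univ U) f) :=
    (map_continuous φ).comp (Hb.continuous_restrict _)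
  have heq : Φ = fun f => φ (Hb.restrict (Set.subset_univ U) f) := by
    refine hΦ.ext_on hd hc fun f hf => ?_
    suffices HasAronBernerValue f (spectrumProj U φ) (φ (Hb.restrict (Set.subset_univ U) f)) from
      HasSum.unique (hΦv f) this
    induction hf using Submodule.span_induction with
    | mem f hf =>
      obtain ⟨γ, n, rfl⟩ := hf
      rw [map_pow, map_pow_of_character]
      exact hasAronBernerValue_ofDual_pow _ γ n
    | zero =>
      rw [map_zero, map_zero]
      refine hasSum_zero.congr_of_eq fun n => ?_
      rw [show taylorForm 0 n = 0 from map_zero (taylorFormL E n), map_zero]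
    | add f g _ _ hf hg =>
      rw [map_add, map_add]
      refine (hf.add hg).congr_of_eq fun n => ?_
      rw [show taylorForm (f + g) n = taylorForm f n + taylorForm g n from
        map_add (taylorFormL E n) f g, map_add]
    | smul c f _ hf =>
      rw [map_smul, map_smul]
      refine (hf.const_smul c).congr_of_eq fun n => ?_
      rw [show taylorForm (c • f) n = c • taylorForm f n from
        map_smul (taylorFormL E n) c f, map_smul]
  rw [← congrFun heq f]
  exact hΦv f

end AronBerner

/-! ### Characters from ultrafilters, and zeros of homogeneous polynomials on lines. -/

section Counterexample

variable {E : Type*} [NormedAddCommGroup E] [NormedSpace ℂ E]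

/-- Limits along ultrafilters of evaluations at points of a `U`-bounded set are characters. -/
theorem exists_character_of_ultrafilter {U : Set E} {ι : Type*} (l : Ultrafilter ι) (y : ι → U)
    (hy : IsUBounded U (Set.range y)) :
    ∃ φ : Mb U, ∀ f : Hb U, Filter.Tendsto (fun i => f (y i)) l (𝓝 (φ f)) := by
  have hlim : ∀ f : Hb U, ∃ w, Filter.Tendsto (fun i => f (y i)) l (𝓝 w) := fun f => by
    obtain ⟨M, hM⟩ := (f.2.2 _ hy).exists_norm_le
    obtain ⟨w, -, hw⟩ := (isCompact_closedBall (0 : ℂ) M).ultrafilter_le_nhds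
      (l.map fun i => f (y i)) (Filter.le_principal_iff.2 (Filter.mem_map.2
        (Filter.univ_mem' fun i => by
          simpa using hM _ ⟨y i, ⟨i, rfl⟩, rfl⟩)))
    exact ⟨w, hw⟩
  choose φ hφ using hlim
  let ψ : Hb U →L[ℂ] ℂ :=
    { toFun := φ
      map_add' := fun f g => tendsto_nhds_unique (hφ (f + g)) ((hφ f).add (hφ g))
      map_smul' := fun c f => tendsto_nhds_unique (hφ (c • f)) ((hφ f).const_smul c)
      cont := continuous_iff_continuousAt.2 fun f => Metric.tendsto_nhds.2 fun ε hε => by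
        have h := Hb.tendsto_nhds_iff.1 (Filter.tendsto_id (x := 𝓝 f)) _ hy
        rw [Metric.tendstoUniformlyOn_iff] at h
        filter_upwards [h (ε / 2) (by positivity)] with g hg
        refine (le_of_tendsto ((hφ g).dist (hφ f)) (Filter.Eventually.of_forall fun i => ?_)).trans_lt
          (half_lt_self hε)
        rw [dist_comm]
        exact (hg _ ⟨i, rfl⟩).le }
  refine ⟨⟨StrongDual.toWeakDual ψ, fun h => ?_, fun f g =>
    tendsto_nhds_unique (hφ (f * g)) ((hφ f).mul (hφ g))⟩, hφ⟩
  have h1 : φ 1 = 1 := tendsto_nhds_unique (hφ 1) tendsto_const_nhds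
  have h0 : φ 1 = 0 := DFunLike.congr_fun h 1
  exact one_ne_zero (h1.symm.trans h0)

theorem pow_card_le_norm_prod {ρ : ℝ} (hρ : 0 ≤ ρ) (s : Multiset ℂ) (hs : ∀ t ∈ s, ρ ≤ ‖t‖) :
    ρ ^ s.card ≤ ‖s.prod‖ := by
  induction s using Multiset.induction_on with
  | empty => simp
  | cons t s ih =>
    rw [Multiset.card_cons, Multiset.prod_cons, norm_mul, pow_succ']
    exact mul_le_mul (hs t (by simp)) (ih fun u hu => hs u (by simp [hu])) (by positivity)
      (norm_nonneg _)

/-- A homogeneous polynomial has a zero of controlled size on each complex line in a direction in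
which it is not small. -/
theorem exists_diag_add_smul_eq_zero {n : ℕ} (hn : n ≠ 0)
    (A : ContinuousMultilinearMap ℂ (fun _ : Fin n => E) ℂ) (x y : E) {δ : ℝ} (hδ : 0 < δ)
    (hy : δ ≤ ‖diag A y‖) :
    ∃ t : ℂ, diag A (x + t • y) = 0 ∧ ‖t‖ ≤ 1 + ‖diag A x‖ / δ := by
  let p : Polynomial ℂ := ∑ s : Finset (Fin n),
    Polynomial.C (A (s.piecewise (fun _ => y) fun _ => x)) * Polynomial.X ^ s.card
  have hp : ∀ t, p.eval t = diag A (x + t • y) := fun t => by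
    rw [add_comm, diag_add]
    simp only [p, Polynomial.eval_finsetSum, Polynomial.eval_mul, Polynomial.eval_C,
      Polynomial.eval_pow, Polynomial.eval_X]
    refine Finset.sum_congr rfl fun s _ => ?_
    have h := A.map_piecewise_smul (fun _ => t) (s.piecewise (fun _ => y) fun _ => x) s
    rw [Finset.prod_const, smul_eq_mul, mul_comm] at h
    rw [← h]
    refine congrArg A (funext fun i => ?_)
    by_cases hi : i ∈ s <;> simp [hi]
  have hdeg : p.natDegree ≤ n := Polynomial.natDegree_sum_le_of_forall_le _ _ fun s _ =>
    (Polynomial.natDegree_C_mul_X_pow_le _ _).trans (by simpa using s.card_le_univ)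
  have hcoeff : p.coeff n = diag A y := by
    simp only [p, Polynomial.finsetSum_coeff, Polynomial.coeff_C_mul_X_pow]
    rw [Finset.sum_eq_single Finset.univ]
    · simp [diag]
    · intro s _ hs
      have := (Finset.card_lt_iff_ne_univ s).2 hs
      rw [Fintype.card_fin] at this
      rw [if_neg (by omega)]
    · simp
  have hy0 : diag A y ≠ 0 := norm_pos_iff.1 (hδ.trans_le hy)
  have hdeg' : p.natDegree = n :=
    le_antisymm hdeg (Polynomial.le_natDegree_of_ne_zero (by rwa [hcoeff]))
  have hp0 : p ≠ 0 := fun h => hy0 (by rw [← hcoeff, h, Polynomial.coeff_zero])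
  -- The constant coefficient is `diag A x` and the leading one `diag A y`. If all roots exceeded `ρ
  -- = 1 + ‖diag A x‖ / δ`, Vieta would give `‖diag A x‖ ≥ δ ρⁿ ≥ δ ρ = δ + ‖diag A x‖`. The summand
  -- `1` provides both `ρ ≤ ρⁿ` and the contradiction.
  by_contra! hcon
  have hroots : ∀ t ∈ p.roots, 1 + ‖diag A x‖ / δ ≤ ‖t‖ := fun t ht =>
    (hcon t (by rw [← hp]; exact (Polynomial.mem_roots hp0).1 ht)).le
  have hρ : 0 ≤ ‖diag A x‖ / δ := by positivity
  have h1 := pow_card_le_norm_prod (by positivity) _ hroots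
  have hsplit := IsAlgClosed.splits p
  rw [← hsplit.natDegree_eq_card_roots, hdeg'] at h1
  have h2 := hsplit.coeff_zero_eq_leadingCoeff_mul_prod_roots
  rw [Polynomial.coeff_zero_eq_eval_zero, hp, Polynomial.leadingCoeff, hdeg', hcoeff, zero_smul,
    add_zero] at h2
  have h3 : ‖diag A x‖ = ‖diag A y‖ * ‖p.roots.prod‖ := by
    conv_lhs => rw [h2]
    simp
  have h4 : 1 + ‖diag A x‖ / δ ≤ (1 + ‖diag A x‖ / δ) ^ n := le_self_pow₀ (by linarith) hn
  have h5 : δ * (1 + ‖diag A x‖ / δ) ≤ ‖diag A x‖ := by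
    rw [h3] at h1 h4 ⊢
    exact mul_le_mul hy (h4.trans h1) (by positivity) (norm_nonneg _)
  rw [mul_add, mul_div_cancel₀ _ hδ.ne'] at h5
  linarith

/-- An entire function that is bounded on bounded sets, as an element of `H_b(E)`. -/
def Hb.ofEntire (f : E → ℂ) (hf : ContDiff ℂ ⊤ f)
    (hb : ∀ R : ℝ, ∃ M, ∀ x, ‖x‖ ≤ R → ‖f x‖ ≤ M) : Hb (Set.univ : Set E) :=
  ⟨fun x => f x, ⟨f, (contDiff_omega_iff_analyticOnNhd.1 hf), fun _ => rfl⟩, fun A hA => by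
    obtain ⟨R, hR⟩ := hA.1.exists_norm_le
    obtain ⟨M, hM⟩ := hb R
    refine isBounded_iff_forall_norm_le.2 ⟨M, ?_⟩
    rintro _ ⟨x, hx, rfl⟩
    exact hM x (hR _ ⟨x, hx, rfl⟩)⟩

/-- The translate `x ↦ A (x + v, …, x + v)` of a homogeneous polynomial, restricted to `U`. -/
noncomputable def Hb.ofDiag (U : Set E) {n : ℕ} (A : ContinuousMultilinearMap ℂ (fun _ : Fin n => E) ℂ) (v : E) :
    Hb U :=
  Hb.restrict (Set.subset_univ U) (Hb.ofEntire (fun x => diag A (x + v))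
    ((contDiff_diag A).comp (contDiff_id.add contDiff_const)) fun R => by
      obtain ⟨M, hM⟩ := exists_norm_diag_le A (R + ‖v‖)
      exact ⟨M, fun x hx => hM _ ((norm_add_le _ _).trans (by linarith))⟩)

/-! ### The domain where a homogeneous polynomial has modulus below one. -/

variable {n : ℕ} (A : ContinuousMultilinearMap ℂ (fun _ : Fin n => E) ℂ)

/-- The open set on which a homogeneous polynomial has modulus less than one. -/
def polynomialDomain : Set E := {x | ‖diag A x‖ < 1}

theorem isOpen_polynomialDomain : IsOpen (polynomialDomain A) :=
  isOpen_lt (contDiff_diag A (m := 0)).continuous.norm continuous_const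

/-- Functionals bound the hull in norm. Translates of the polynomial show that the same `ε` serves
for the hull, first with modulus at most `1`; the maximum principle makes this strict, since the
centre of the ball lies in the domain. -/
theorem isHbConvex_polynomialDomain : IsHbConvex (polynomialDomain A) := by
  rintro S ⟨hSb, ε, hε, hS⟩
  refine ⟨?_, ε, hε, fun x hx => ?_⟩
  · obtain ⟨R, hR⟩ := hSb.exists_norm_le
    refine isBounded_iff_forall_norm_le.2 ⟨|R|, ?_⟩
    rintro _ ⟨x, hx, rfl⟩
    refine NormedSpace.norm_le_dual_bound ℂ (x : E) (abs_nonneg R) fun γ => ?_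
    refine (hx (Hb.ofDual _ γ)).trans ?_
    rw [mul_comm]
    refine Real.iSup_le (fun a => ?_) (by positivity)
    exact γ.le_of_opNorm_le_of_le le_rfl ((hR _ ⟨a, a.2, rfl⟩).trans (le_abs_self R))
  · have hle : ∀ y ∈ Metric.ball (x : E) ε, ‖diag A y‖ ≤ 1 := fun y hy => by
      have h := hx (Hb.ofDiag _ A (y - x))
      have h1 : Hb.ofDiag (polynomialDomain A) A (y - x) x = diag A y := by
        change diag A ((x : E) + (y - x)) = _
        rw [add_sub_cancel]
      rw [h1] at h
      refine h.trans (Real.iSup_le (fun a => ?_) zero_le_one)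
      have h2 : ((a : polynomialDomain A) : E) + (y - x) ∈ polynomialDomain A :=
        hS a a.2 (by simpa [dist_eq_norm] using hy)
      exact (show ‖diag A (((a : polynomialDomain A) : E) + (y - x))‖ < 1 from h2).le
    intro y hy
    refine lt_of_le_of_ne (hle y hy) fun h1 => ?_
    have hmax := Complex.norm_eqOn_of_isPreconnected_of_isMaxOn (f := diag A)
      (convex_ball (x : E) ε).isPreconnected Metric.isOpen_ball
      ((contDiff_diag A (m := 1)).differentiable (by simp)).differentiableOn hy
      (fun w hw => by simpa [h1] using hle w hw) (Metric.mem_ball_self hε)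
    have hx1 : ‖diag A (x : E)‖ = ‖diag A y‖ := hmax
    have hx2 : ‖diag A (x : E)‖ < 1 := x.2
    linarith

/-- If the value `c` had modulus above `1`, the powers of `c⁻¹P` would tend to `0` uniformly on the
domain, while `φ` sends each of them to `1`. -/
theorem norm_le_one_of_character (φ : Mb (polynomialDomain A)) :
    ‖φ (Hb.ofDiag _ A 0)‖ ≤ 1 := by
  by_contra! h
  set c := φ (Hb.ofDiag _ A 0) with hc
  have hc0 : c ≠ 0 := norm_pos_iff.1 (one_pos.trans h)
  have hlim : Filter.Tendsto (fun k : ℕ => (c⁻¹ • Hb.ofDiag (polynomialDomain A) A 0) ^ k)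
      Filter.atTop (𝓝 0) := by
    refine Hb.tendsto_nhds_iff.2 fun S _ => Metric.tendstoUniformlyOn_iff.2 fun ε hε => ?_
    have hgeo := tendsto_pow_atTop_nhds_zero_of_lt_one (norm_nonneg c⁻¹)
      (by rw [norm_inv]; exact inv_lt_one_of_one_lt₀ h)
    filter_upwards [hgeo.eventually (gt_mem_nhds hε)] with k hk x _
    have h1 : ((c⁻¹ • Hb.ofDiag (polynomialDomain A) A 0) ^ k) x =
      (c⁻¹ * diag A ((x : E) + 0)) ^ k := rfl
    have h2 : (0 : Hb (polynomialDomain A)) x = 0 := rfl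
    have h3 : ‖diag A (x : E)‖ < 1 := x.2
    rw [h1, h2, dist_zero_left, add_zero, norm_pow, norm_mul]
    refine lt_of_le_of_lt ?_ hk
    gcongr
    exact mul_le_of_le_one_right (norm_nonneg _) h3.le
  have h1 := ((map_continuous φ).tendsto 0).comp hlim
  have h2 : ∀ k : ℕ, φ ((c⁻¹ • Hb.ofDiag (polynomialDomain A) A 0) ^ k) = 1 := fun k => by
    rw [map_pow_of_character, map_smul, ← hc, smul_eq_mul, inv_mul_cancel₀ hc0, one_pow]
  have h3 := tendsto_nhds_unique h1 (tendsto_const_nhds.congr fun k => (h2 k).symm)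
  rw [map_zero] at h3
  exact zero_ne_one h3

theorem inclusion_notMem_evaluationPoints {a : E} (ha : 1 < ‖diag A a‖) :
    NormedSpace.inclusionInDoubleDual ℂ E a ∉ evaluationPoints (polynomialDomain A) := by
  rintro ⟨φ, hφ⟩
  have h := HasSum.unique (hφ _) (hasAronBernerValue_inclusion (Hb.ofEntire
    (fun x => diag A (x + 0)) ((contDiff_diag A).comp (contDiff_id.add contDiff_const)) fun R => by
      simpa using exists_norm_diag_le A R) a)
  have h1 := norm_le_one_of_character A φ
  have h2 : φ (Hb.ofDiag _ A 0) = diag A (a + 0) := h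
  rw [h2, add_zero] at h1
  exact h1.not_gt ha

variable {A}

theorem ne_zero_of_not_weaklyContinuousAtZero (hA : ¬ WeaklyContinuousAtZero (diag A)) : n ≠ 0 := by
  rintro rfl
  refine hA fun R ε hε => ⟨∅, fun x _ _ => ?_⟩
  have : diag A x = diag A 0 := congrArg A (Subsingleton.elim _ _)
  rw [this, sub_self, norm_zero]
  exact hε.le

theorem diag_zero_of_ne_zero (hn : n ≠ 0) : diag A 0 = 0 :=
  have : NeZero n := ⟨hn⟩
  diag_zero A

/-- By homogeneity a polynomial of positive degree bounded by `1` on all of `E` is zero, hence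
weakly continuous. -/
theorem exists_one_lt_norm_diag (hA : ¬ WeaklyContinuousAtZero (diag A)) :
    ∃ a, 1 < ‖diag A a‖ := by
  by_contra! h
  have hn := ne_zero_of_not_weaklyContinuousAtZero hA
  refine hA fun R ε hε => ⟨∅, fun x _ _ => ?_⟩
  rw [diag_zero_of_ne_zero hn, sub_zero]
  have h1 := h (((max 1 ε⁻¹ : ℝ) : ℂ) • x)
  have h2 : 1 ≤ max 1 ε⁻¹ := le_max_left _ _
  rw [diag_smul, norm_mul, norm_pow, Complex.norm_real, Real.norm_of_nonneg (by positivity)] at h1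
  have h3 : ε⁻¹ ≤ max 1 ε⁻¹ ^ n := (le_max_right _ _).trans (le_self_pow₀ h2 hn)
  have h4 : ε⁻¹ * ‖diag A x‖ ≤ 1 := (mul_le_mul_of_nonneg_right h3 (norm_nonneg _)).trans h1
  rwa [inv_mul_le_iff₀ hε, mul_one] at h4

/-- If a homogeneous polynomial is not weakly continuous at zero on bounded sets, every point of
`E` is a limit of zeros of the polynomial along a bounded weakly convergent ultrafilter. -/
theorem range_inclusion_subset_range_spectrumProj (hA : ¬ WeaklyContinuousAtZero (diag A)) :
    Set.range (NormedSpace.inclusionInDoubleDual ℂ E) ⊆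
      Set.range (spectrumProj (polynomialDomain A)) := by
  classical
  have hn := ne_zero_of_not_weaklyContinuousAtZero hA
  rintro _ ⟨x, rfl⟩
  unfold WeaklyContinuousAtZero at hA
  push Not at hA
  obtain ⟨R, δ, hδ, hF⟩ := hA
  choose w hwR hw0 hwδ using hF
  have hroot : ∀ F, ∃ t : ℂ, diag A (x + t • w F) = 0 ∧ ‖t‖ ≤ 1 + ‖diag A x‖ / δ := fun F =>
    exists_diag_add_smul_eq_zero hn A x (w F) hδ (by
      have := hwδ F
      rw [diag_zero_of_ne_zero hn, sub_zero] at this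
      exact this.le)
  choose t ht0 htb using hroot
  let y : Finset (StrongDual ℂ E) → polynomialDomain A := fun F =>
    ⟨x + t F • w F, by
      change ‖diag A (x + t F • w F)‖ < 1
      rw [ht0, norm_zero]
      exact one_pos⟩
  let R' : ℝ := ‖x‖ + (1 + ‖diag A x‖ / δ) * R
  have hyR : ∀ F, ‖(y F : E)‖ ≤ R' := fun F => by
    refine (norm_add_le _ _).trans (add_le_add le_rfl ?_)
    rw [norm_smul]
    exact mul_le_mul (htb F) (hwR F) (norm_nonneg _) (by positivity)
  have hy : IsUBounded (polynomialDomain A) (Set.range y) := by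
    refine ⟨isBounded_iff_forall_norm_le.2 ⟨R', ?_⟩, ?_⟩
    · rintro _ ⟨_, ⟨F, rfl⟩, rfl⟩
      exact hyR F
    -- The points `y F` are zeros, so a Lipschitz constant `M` of the polynomial keeps it below `1`
    -- in modulus within distance `min 1 M⁻¹`.
    obtain ⟨M, hM0, hM⟩ := exists_norm_sub_le_of_bounded
      ((contDiff_diag A (m := 1)).differentiable (by simp)) (exists_norm_diag_le A) (R' + 1)
    refine ⟨min 1 M⁻¹, by positivity, ?_⟩
    rintro _ ⟨F, rfl⟩ z hz
    rw [mem_ball_iff_norm] at hz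
    have hz1 : ‖z‖ ≤ R' + 1 := by
      linarith [norm_sub_norm_le z (y F), hyR F, min_le_left 1 M⁻¹]
    have h := hM z (y F) hz1 (by linarith [hyR F])
    rw [show diag A (y F : E) = 0 from ht0 F, sub_zero] at h
    refine h.trans_lt ?_
    calc M * ‖z - y F‖ < M * M⁻¹ := by
          gcongr
          exact hz.trans_le (min_le_right _ _)
      _ = 1 := mul_inv_cancel₀ hM0.ne'
  -- Finite sets of functionals are directed by inclusion; once `F` contains `γ`, the value `γ (y
  -- F)` is exactly `γ x`.
  obtain ⟨φ, hφ⟩ := exists_character_of_ultrafilter (Ultrafilter.of Filter.atTop) y hy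
  refine ⟨φ, ContinuousLinearMap.ext fun γ => ?_⟩
  refine tendsto_nhds_unique (hφ (Hb.ofDual _ γ)) (tendsto_const_nhds.congr' ?_)
  refine (Ultrafilter.of_le Filter.atTop) ?_
  filter_upwards [Filter.eventually_ge_atTop {γ}] with F hF
  change γ x = γ (x + t F • w F)
  rw [map_add, map_smul, hw0 F γ (hF (by simp)), smul_zero, add_zero]

end Counterexample

/-! ### The equivalences and the final assertion. -/

theorem mainTheorem8 {E : Type*} [NormedAddCommGroup E] [NormedSpace ℂ E] [CompleteSpace E]
    (hE : HasApproximationProperty (StrongDual ℂ E)) :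
    List.TFAE [
      Dense (finiteTypePolynomials E : Set (Hb (Set.univ : Set E))),
      ∀ U : Set E, IsOpen U → evaluationPoints U = Set.range (spectrumProj U),
      ∀ U : Set E, IsOpen U → IsHbConvex U →
        evaluationPoints U = Set.range (spectrumProj U)] ∧
    (¬ Dense (finiteTypePolynomials E : Set (Hb (Set.univ : Set E))) →
      ∃ U : Set E, IsOpen U ∧ U ≠ Set.univ ∧ IsHbConvex U ∧
        Set.range (NormedSpace.inclusionInDoubleDual ℂ E) ⊆ Set.range (spectrumProj U)) := by
  -- One domain serves twice: its last property refutes (iii), the others are the final assertion.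
  have key : ¬ Dense (finiteTypePolynomials E : Set (Hb (Set.univ : Set E))) →
      ∃ U : Set E, IsOpen U ∧ U ≠ Set.univ ∧ IsHbConvex U ∧
        Set.range (NormedSpace.inclusionInDoubleDual ℂ E) ⊆ Set.range (spectrumProj U) ∧
        ¬ Set.range (NormedSpace.inclusionInDoubleDual ℂ E) ⊆ evaluationPoints U := by
    intro hd
    obtain ⟨n, A, hA⟩ : ∃ (n : ℕ) (A : ContinuousMultilinearMap ℂ (fun _ : Fin n => E) ℂ),
        ¬ WeaklyContinuousAtZero (diag A) := by
      by_contra! H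
      exact hd (dense_finiteTypePolynomials fun f => finiteTypeApproximable_entire f fun n =>
        (isSymmetricForm_taylorForm f n).finiteTypeApproximable hE H)
    obtain ⟨a, ha⟩ := exists_one_lt_norm_diag hA
    refine ⟨polynomialDomain A, isOpen_polynomialDomain A, fun h => ?_,
      isHbConvex_polynomialDomain A, range_inclusion_subset_range_spectrumProj hA,
      fun h => inclusion_notMem_evaluationPoints A ha (h ⟨a, rfl⟩)⟩
    exact ha.not_gt (show a ∈ polynomialDomain A from h ▸ Set.mem_univ a)
  refine ⟨?_, fun hd => ?_⟩
  · tfae_have 1 → 2 := fun hd U _ =>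
      (evaluationPoints_subset U).antisymm (range_spectrumProj_subset hd U)
    tfae_have 2 → 3 := fun h U hU _ => h U hU
    tfae_have 3 → 1 := fun h => by
      by_contra hd
      obtain ⟨U, hU, -, hconv, hsub, hnot⟩ := key hd
      exact hnot (h U hU hconv ▸ hsub)
    tfae_finish
  · obtain ⟨U, hU, hne, hconv, hsub, -⟩ := key hd
    exact ⟨U, hU, hne, hconv, hsub⟩
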